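/- Let $d\ge 1$ and let $\nu$ be a Lévy measure on $\mathbb{R}^d$, i.e. $\nu(\{0\})=0$ and $\int_{\mathbb{R}^d}\min(1,|z|^2)\,\nu(dz)<\infty$. Let $Z=(Z(t))_{t\ge 0}$ be a Lévy process on $\mathbb{R}^d$ with Lévy measure $\nu$ and symbol $\Psi_\nu$, i.e. \[ \mathbb{E}\big[e^{i\xi\cdot Z(t)}\big]=e^{-t\Psi_\nu(\xi)},\qquad \Psi_\nu(\xi)=\int_{\mathbb{R}^d}\Big(1+\mathbf 1_{\{|z|\le 1\}}(\xi\cdot z)\,i-e^{i(\xi\cdot z)}\Big)\nu(dz),\qquad t\ge 0,\ \xi\in\mathbb{R}^d. \] Suppose that \[ \liminf_{|\xi|\to\infty}\frac{\mathrm{Re}\,\Psi_\nu(\xi)}{\log(1+|\xi|)}=\infty , \] and that there exist $t_0>0$ and $C_1>0$ such that \[ \int_{\mathbb{R}^d}e^{-t\,\mathrm{Re}\,\Psi_\nu(\xi)}|\xi|^{d+2}\,d\xi\le C_1\,\Xi(t)^{2d+2},\qquad t\in(0,t_0), \] where $\delta(\eta)=\sup_{|\xi|\le\eta}\mathrm{Re}\,\Psi_\nu(\xi)$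 and $\Xi(t)=\delta^{-1}(1/t)$, with the generalized inverse $\delta^{-1}(s)=\inf\{\eta\ge 0:\delta(\eta)\ge s\}$. Then for every $t>0$ the random variable $Z(t)$ has a density $g_t\in C^1(\mathbb{R}^d)$ with $\nabla g_t\in L^1(\mathbb{R}^d)$, and there exist constants $C_2>0$ and $t_1>0$ such that \[ \|\nabla g_t\|_{L^1(\mathbb{R}^d)}\le C_2\,\Xi(t\wedge t_1),\qquad t>0 . \] -/

import Mathlib

open MeasureTheory ProbabilityTheory Filter Topology
open scoped NNReal ENNReal Gradient

/-- A Lévy process on `ℝ^d`, indexed by `[0, ∞)`: it starts at `0` almost surely, has independent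
and stationary increments and is continuous in probability. -/
structure IsLevyProcess {d : ℕ} {Ω : Type*} [MeasurableSpace Ω]
    (Z : ℝ≥0 → Ω → EuclideanSpace ℝ (Fin d)) (P : Measure Ω) : Prop where
  measurable : ∀ t, Measurable (Z t)
  zero : ∀ᵐ ω ∂P, Z 0 ω = 0
  indep : HasIndepIncrements Z P
  stationary : ∀ s h : ℝ≥0, P.map (fun ω => Z (s + h) ω - Z s ω) = P.map (Z h)
  continuous : ∀ s : ℝ≥0, TendstoInMeasure P Z (𝓝 s) (Z s)

/-- A Lévy measure on `ℝ^d`: no mass at the origin and `∫ min(1, |z|²) ν(dz) < ∞`. -/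
structure IsLevyMeasure {d : ℕ} (ν : Measure (EuclideanSpace ℝ (Fin d))) : Prop where
  zero : ν {0} = 0
  lintegral_lt_top : ∫⁻ z, ENNReal.ofReal (min 1 (‖z‖ ^ 2)) ∂ν < ∞

open Classical in
/-- The pure jump Lévy symbol
`Ψ_ν(ξ) = ∫ (1 + 𝟙_{|z| ≤ 1} (ξ·z) i - exp(i (ξ·z))) ν(dz)`. -/
noncomputable def levySymbol {d : ℕ} (ν : Measure (EuclideanSpace ℝ (Fin d)))
    (ξ : EuclideanSpace ℝ (Fin d)) : ℂ :=
  ∫ z, (1 + (if ‖z‖ ≤ 1 then ((inner ℝ ξ z : ℝ) : ℂ) * Complex.I else 0)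
    - Complex.exp (Complex.I * ((inner ℝ ξ z : ℝ) : ℂ))) ∂ν

/-- `δ(η) = sup_{|ξ| ≤ η} Re Ψ_ν(ξ)`. -/
noncomputable def levyDelta {d : ℕ} (ν : Measure (EuclideanSpace ℝ (Fin d))) (η : ℝ) : ℝ :=
  sSup ((fun ξ => (levySymbol ν ξ).re) '' Metric.closedBall 0 η)

/-- `Ξ(t) = δ⁻¹(1/t)`, where `δ⁻¹(s) = inf {η ≥ 0 : δ(η) ≥ s}` is the (generalized) inverse of the
nondecreasing function `δ`. -/
noncomputable def levyXi {d : ℕ} (ν : Measure (EuclideanSpace ℝ (Fin d))) (t : ℝ) : ℝ :=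
  sInf {η : ℝ | 0 ≤ η ∧ 1 / t ≤ levyDelta ν η}

/-!
Write `R = Ξ(s)` and let `Ψ` be the symbol of `ν`. By definition of the generalized inverse,
`s Re Ψ ≤ 1` on the open ball of radius `R`. Integrating `1 - cos` over coordinate segments turns
this into bounds for the Lévy measure itself: with the truncation level `r = 4 d / R`, both
`s ν{‖z‖ > r}` and `s R² ∫_{‖z‖ ≤ r} ‖z‖² ν(dz)` are bounded by constants depending only on `d`
(`IsLevyMeasure.measure_norm_gt_le`, `IsLevyMeasure.integral_sq_le`).

The factor of `exp (-s Ψ)` due to jumps larger than `r`, together with the drift coming from the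
change of truncation, is the characteristic function of a translated compound Poisson law
(`IsLevyMeasure.exists_charFun_mul`). Convolution with a probability measure does not increase `L¹`
norms (`lintegral_fourier_charFun_smul_le`), so only the factor `h` of the small jumps has to be
estimated. For the same reason it suffices to treat `s = min t t₁`: the law at time `t - s` is
absorbed in the probability factor.

After rescaling space by `R`, the small-jump factor is `f = exp (-S)`, where `S` is the compensated
symbol of a measure supported in a fixed ball with bounded second moment. Hence `S` is smooth,
`‖D^i S(v)‖ ≤ (A (1 + ‖v‖)) ^ i` for `i ≥ 1` (`contDiff_compensatedSymbol`), and the `n`-th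
derivative of `f` is at most a multiple of `(1 + ‖v‖) ^ n ‖f(v)‖`. Up to `n = d + 1`, with one further
power of `‖v‖` for the gradient, these have bounded integrals: up to a constant factor `‖f(v)‖` is
`exp (-s Re Ψ)` at a dilated point, and the integral condition with weight `|ξ| ^ (d + 2)` is
exactly what is needed. So `𝓕 f` and `∇ 𝓕 f` decay like `(1 + ‖w‖) ^ (-(d + 1))` and have bounded
`L¹` norms (`exists_lintegral_fourier_exp_compensatedSymbol_le`); undoing the scaling multiplies the
norm of the gradient by `R` (`exists_smallJumps_bound`).

Finally, the Fourier transform of the characteristic function is integrable, and Fourier inversion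
with uniqueness of characteristic functions shows that it is a nonnegative density
(`density_of_integrable_fourier`).
-/

open scoped FourierTransform

/-! ### Convolution and densities on the Fourier side -/

section Fourier

theorem charFun_two_pi_smul {V : Type*} [NormedAddCommGroup V]
    [InnerProductSpace ℝ V] [MeasurableSpace V] (m : Measure V) (ξ : V) :
    charFun m ((2 * Real.pi) • ξ) = ∫ y, (Real.fourierChar (inner ℝ y ξ) : ℂ) ∂m := by
  simp only [charFun_apply, Real.fourierChar_apply, inner_smul_right]

variable {V : Type*} [NormedAddCommGroup V] [InnerProductSpace ℝ V] [MeasurableSpace V]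
  [BorelSpace V]

/-- The compound Poisson law with finite jump measure `μ`, built as the sum of the convolution
powers `e^{-μ(V)} μ^{∗n} / n!`. -/
theorem exists_compoundPoisson [SecondCountableTopology V] (μ : Measure V) [IsFiniteMeasure μ] :
    ∃ m : Measure V, IsProbabilityMeasure m ∧
      ∀ ξ, charFun m ξ = Complex.exp (charFun μ ξ - μ.real Set.univ) := by
  obtain ⟨pw, pw_zero, pw_succ⟩ : ∃ pw : ℕ → Measure V, pw 0 = Measure.dirac 0 ∧
      ∀ n, pw (n + 1) = pw n ∗ μ :=
    ⟨fun n => Nat.rec (Measure.dirac 0) (fun _ κ => κ ∗ μ) n, rfl, fun _ => rfl⟩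
  have hpw : ∀ n, IsFiniteMeasure (pw n) := by
    intro n
    induction n with
    | zero => rw [pw_zero]; infer_instance
    | succ n ih => rw [pw_succ]; infer_instance
  have hchar : ∀ n ξ, charFun (pw n) ξ = charFun μ ξ ^ n := by
    intro n ξ
    induction n with
    | zero => simp [pw_zero, charFun_dirac]
    | succ n ih => rw [pw_succ, charFun_conv, ih, pow_succ]
  set M : ℝ := μ.real Set.univ with hM
  have hmass : ∀ n, (pw n).real Set.univ = M ^ n := by
    intro n
    have h1 := hchar n 0
    rw [charFun_zero, charFun_zero] at h1
    exact_mod_cast h1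
  let c : ℕ → ℝ := fun n => Real.exp (-M) / n.factorial
  have hc : ∀ n, 0 ≤ c n := fun n => by positivity
  let m : Measure V := Measure.sum fun n => ENNReal.ofReal (c n) • pw n
  have hsum : HasSum (fun n => c n * M ^ n) 1 := by
    have h1 := (NormedSpace.expSeries_div_hasSum_exp (𝔸 := ℝ) M).mul_left (Real.exp (-M))
    rw [← Real.exp_eq_exp_ℝ, ← Real.exp_add, neg_add_cancel, Real.exp_zero] at h1
    convert! h1 using 2 with n
    simp only [c]; ring
  have hm : IsProbabilityMeasure m := by
    constructor
    have h1 : ∀ n, ENNReal.ofReal (c n) * pw n Set.univ = ENNReal.ofReal (c n * M ^ n) := by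
      intro n
      rw [ENNReal.ofReal_mul (hc n), ← hmass n, Measure.real, ENNReal.ofReal_toReal]
      exact measure_ne_top _ _
    simp only [m, Measure.sum_apply _ MeasurableSet.univ, Measure.smul_apply, smul_eq_mul, h1]
    rw [← ENNReal.ofReal_tsum_of_nonneg (fun n => mul_nonneg (hc n) (by positivity))
      hsum.summable, hsum.tsum_eq, ENNReal.ofReal_one]
  refine ⟨m, hm, fun ξ => ?_⟩
  have hint : Integrable (fun x : V => Complex.exp ((inner ℝ x ξ : ℝ) * Complex.I)) m :=
    (integrable_const (1 : ℝ)).mono (by fun_prop) (by simp)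
  have h1 := hasSum_integral_measure hint
  have h2 : ∀ n, ∫ x : V, Complex.exp ((inner ℝ x ξ : ℝ) * Complex.I)
      ∂(ENNReal.ofReal (c n) • pw n) = (c n : ℂ) * charFun μ ξ ^ n := by
    intro n
    rw [integral_smul_measure, ← charFun_apply, hchar, ENNReal.toReal_ofReal (hc n)]
    simp
  simp only [h2] at h1
  have h3 : HasSum (fun n => (c n : ℂ) * charFun μ ξ ^ n)
      (Complex.exp (charFun μ ξ - (M : ℂ))) := by
    have h4 := (NormedSpace.expSeries_div_hasSum_exp (𝔸 := ℂ) (charFun μ ξ)).mul_left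
      (Complex.exp (-(M : ℂ)))
    rw [← Complex.exp_eq_exp_ℂ, ← Complex.exp_add, neg_add_eq_sub] at h4
    convert! h4 using 2 with n
    simp only [c]; push_cast; ring
  rw [charFun_apply]
  exact h1.unique h3

variable [FiniteDimensional ℝ V] {F : Type*} [NormedAddCommGroup F] [NormedSpace ℂ F]
  [CompleteSpace F]

/-- Multiplying by the characteristic function of `m` on the Fourier side is convolution with `m`
on the space side. -/
theorem fourier_charFun_smul (m : Measure V) [IsFiniteMeasure m] {h : V → F} (hh : Integrable h)
    (x : V) :
    𝓕 (fun ξ => charFun m ((2 * Real.pi) • ξ) • h ξ) x = ∫ y, 𝓕 h (x - y) ∂m := by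
  have hI : Integrable (Function.uncurry fun (ξ y : V) =>
      Real.fourierChar (-inner ℝ ξ (x - y)) • h ξ) (volume.prod m) := by
    have h1 : Integrable (fun p : V × V => h p.1) (volume.prod m) := hh.comp_fst m
    refine h1.norm.mono' ?_ (by simp [Function.uncurry, Circle.norm_smul])
    refine AEStronglyMeasurable.fun_smul ?_ h1.1
    exact (Real.continuous_fourierChar.comp (by fun_prop)).aestronglyMeasurable
  simp only [Real.fourier_eq]
  rw [← integral_integral_swap hI]
  congr 1 with ξ
  have h2 : ∀ y, Real.fourierChar (-inner ℝ ξ (x - y)) • h ξ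
      = (Real.fourierChar (inner ℝ y ξ) : ℂ) • (Real.fourierChar (-inner ℝ ξ x) • h ξ) := by
    intro y
    have : -inner ℝ ξ (x - y) = inner ℝ y ξ + -inner ℝ ξ x := by
      rw [inner_sub_right, real_inner_comm ξ y]; ring
    rw [this, AddChar.map_add_eq_mul, Circle.smul_def, Circle.smul_def, Circle.coe_mul, mul_smul]
  simp only [h2]
  rw [integral_smul_const, charFun_two_pi_smul, smul_comm]

/-- Convolution with a probability measure does not increase the `L¹` norm. -/
theorem lintegral_fourier_charFun_smul_le (m : Measure V) [IsProbabilityMeasure m] {h : V → F}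
    (hh : Integrable h) :
    ∫⁻ x, ‖𝓕 (fun ξ => charFun m ((2 * Real.pi) • ξ) • h ξ) x‖ₑ ≤ ∫⁻ x, ‖𝓕 h x‖ₑ := by
  have hcont : Continuous (𝓕 h) := VectorFourier.fourierIntegral_continuous
    Real.continuous_fourierChar (by exact continuous_inner) hh
  calc ∫⁻ x, ‖𝓕 (fun ξ => charFun m ((2 * Real.pi) • ξ) • h ξ) x‖ₑ
      ≤ ∫⁻ x, ∫⁻ y, ‖𝓕 h (x - y)‖ₑ ∂m := by
        refine lintegral_mono fun x => ?_
        rw [fourier_charFun_smul m hh]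
        exact enorm_integral_le_lintegral_enorm _
    _ = ∫⁻ y, ∫⁻ x, ‖𝓕 h (x - y)‖ₑ ∂volume ∂m := by
        refine lintegral_lintegral_swap ?_
        have : Continuous fun p : V × V => ‖𝓕 h (p.1 - p.2)‖ₑ := by fun_prop
        exact this.aemeasurable
    _ = ∫⁻ x, ‖𝓕 h x‖ₑ := by
        have h1 : ∀ y, ∫⁻ x, ‖𝓕 h (x - y)‖ₑ = ∫⁻ x, ‖𝓕 h x‖ₑ := fun y =>
          lintegral_sub_right_eq_self (fun x => ‖𝓕 h x‖ₑ) y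
        simp [h1]

/-- A law whose characteristic function `φ` (in the normalization of the Fourier transform) and
whose Fourier transform `𝓕 φ` are integrable has the density `𝓕 φ`. -/
theorem density_of_integrable_fourier (μ : Measure V) [IsProbabilityMeasure μ]
    {φ : V → ℂ} (hφ : ∀ ξ, φ ξ = charFun μ ((2 * Real.pi) • ξ))
    (hint : Integrable φ) (hFint : Integrable (𝓕 φ)) :
    (∀ x, 0 ≤ (𝓕 φ x).re) ∧
      μ = volume.withDensity (fun x => ENNReal.ofReal (𝓕 φ x).re) := by
  have hφc : Continuous φ := by
    have : φ = fun ξ => charFun μ ((2 * Real.pi) • ξ) := funext hφ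
    rw [this]; fun_prop
  have hGc : Continuous (𝓕 φ) := VectorFourier.fourierIntegral_continuous
    Real.continuous_fourierChar (by exact continuous_inner) hint
  have hreal : ∀ x, ((𝓕 φ x).re : ℂ) = 𝓕 φ x := by
    intro x
    refine Complex.conj_eq_iff_re.1 ?_
    rw [Real.fourier_eq, ← integral_conj, ← integral_neg_eq_self]
    congr 1 with ξ
    simp only [Circle.smul_def, smul_eq_mul, map_mul, inner_neg_left, neg_neg, hφ, smul_neg,
      charFun_neg, Complex.conj_conj]
    rw [← Circle.coe_inv_eq_conj, AddChar.map_neg_eq_inv]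
  set g : V → ℝ := fun x => (𝓕 φ x).re with hg
  have hgc : Continuous g := Complex.continuous_re.comp hGc
  have hgint : Integrable g := hFint.re
  have hinv := hφc.fourierInv_fourier_eq hint hFint
  have hchar : ∀ ξ, ∫ x, Complex.exp ((inner ℝ x ξ : ℝ) * Complex.I) * (g x : ℂ) = charFun μ ξ := by
    intro ξ
    have h1 := congrFun hinv ((2 * Real.pi)⁻¹ • ξ)
    rw [hφ, smul_smul, mul_inv_cancel₀ (by positivity), one_smul, Real.fourierInv_eq'] at h1
    rw [← h1]
    congr 1 with x
    rw [hreal, smul_eq_mul, inner_smul_right]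
    congr 3
    push_cast
    field_simp
  -- Compare the laws with densities `g⁺` and `g⁻`: once `g⁺ dx = μ + g⁻ dx` is known from
  -- characteristic functions, disjointness of the supports forces `g⁻ = 0`.
  let νp : Measure V := volume.withDensity fun x => ENNReal.ofReal (g x)
  let νn : Measure V := volume.withDensity fun x => ENNReal.ofReal (-g x)
  have fin_p : IsFiniteMeasure νp := isFiniteMeasure_withDensity_ofReal hgint.2
  have fin_n : IsFiniteMeasure νn := isFiniteMeasure_withDensity_ofReal hgint.neg.2
  have hden : ∀ (u : V → ℝ), Continuous u → ∀ ξ,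
      charFun (volume.withDensity fun x => ENNReal.ofReal (u x)) ξ
        = ∫ x, ((max (u x) 0 : ℝ) : ℂ) * Complex.exp ((inner ℝ x ξ : ℝ) * Complex.I) := by
    intro u hu ξ
    rw [charFun_apply, integral_withDensity_eq_integral_toReal_smul (by fun_prop)
      (Eventually.of_forall fun x => ENNReal.ofReal_lt_top)]
    simp [ENNReal.toReal_ofReal', Complex.real_smul]
  have key : νp = μ + νn := by
    refine Measure.ext_of_charFun (funext fun ξ => ?_)
    have hadd : charFun (μ + νn) ξ = charFun μ ξ + charFun νn ξ := by
      simp only [charFun_apply]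
      refine integral_add_measure ?_ ?_ <;>
      exact (integrable_const (1 : ℝ)).mono (by fun_prop) (by simp)
    rw [hadd, hden g hgc, hden (fun x => -g x) hgc.neg, ← hchar, ← integral_add]
    · congr 1 with x
      have : max (g x) 0 = g x + max (-g x) 0 := by
        rcases le_total 0 (g x) with h | h <;> simp [h]
      rw [this]; push_cast; ring
    · refine (hgint.ofReal (𝕜 := ℂ)).bdd_mul (c := 1) (by fun_prop) (by simp)
    · refine (hgint.neg.pos_part.ofReal (𝕜 := ℂ)).mul_bdd (c := 1) (by fun_prop) (by simp)
  have hnonneg : ∀ x, 0 ≤ g x := by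
    -- on the open set `{g < 0}` the measure `νp` vanishes, hence so does `νn ≤ νp`
    by_contra! hx
    obtain ⟨x₀, hx₀⟩ := hx
    have hopen : IsOpen {x | g x < 0} := isOpen_lt hgc continuous_const
    have h0 : νp {x | g x < 0} = 0 := by
      rw [withDensity_apply _ hopen.measurableSet]
      refine setLIntegral_eq_zero hopen.measurableSet fun x hx => ?_
      exact ENNReal.ofReal_of_nonpos (le_of_lt hx)
    have h1 : νn {x | g x < 0} = 0 := by
      rw [key, Measure.add_apply] at h0
      exact (add_eq_zero.1 h0).2
    rw [withDensity_apply _ hopen.measurableSet, setLIntegral_eq_zero_iff hopen.measurableSet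
      (by fun_prop)] at h1
    have h2 : volume {x | g x < 0} = 0 := by
      refine measure_mono_null (fun x (hx : g x < 0) => ?_) (ae_iff.1 h1)
      simpa using hx
    exact (hopen.measure_pos volume ⟨x₀, hx₀⟩).ne' h2
  refine ⟨hnonneg, ?_⟩
  have hn0 : νn = 0 := by
    have : (fun x => ENNReal.ofReal (-g x)) = 0 := by
      funext x; simpa using hnonneg x
    simp only [νn, this, withDensity_zero]
  rw [hn0, add_zero] at key
  exact key.symm

end Fourier

/-! ### Smoothness of the symbol of bounded jumps -/

section SmoothSymbol

variable {V : Type*} [NormedAddCommGroup V] [InnerProductSpace ℝ V] [MeasurableSpace V]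

/-- The fully compensated symbol `∫ (1 + 2πi⟨z, v⟩ - e^{2πi⟨z, v⟩}) ρ(dz)` of a jump measure `ρ`
with finite second moment. The frequency is scaled by `2π` to match the Fourier transform. -/
noncomputable def compensatedSymbol (ρ : Measure V) (v : V) : ℂ :=
  ∫ z, (1 + 2 * Real.pi * (inner ℝ z v : ℝ) * Complex.I
    - (Real.fourierChar (inner ℝ z v) : ℂ)) ∂ρ

theorem norm_one_sub_fourierChar_le (x : ℝ) :
    ‖(1 : ℂ) - Real.fourierChar x‖ ≤ 2 * Real.pi * |x| := by
  rw [norm_sub_rev, Real.fourierChar_apply, mul_comm _ Complex.I]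
  refine (Real.norm_exp_I_mul_ofReal_sub_one_le).trans ?_
  rw [Real.norm_eq_abs, abs_mul, abs_of_pos (by positivity : 0 < 2 * Real.pi)]

theorem norm_one_add_I_sub_exp_le (x : ℝ) :
    ‖(1 : ℂ) + x * Complex.I - Complex.exp (x * Complex.I)‖ ≤ 2 * x ^ 2 := by
  rcases le_total |x| 1 with h | h
  · have h1 := Complex.norm_exp_sub_one_sub_id_le (x := x * Complex.I) (by simpa using h)
    rw [norm_sub_rev]
    have h2 : ‖(x : ℂ) * Complex.I‖ ^ 2 = x ^ 2 := by simp
    rw [h2] at h1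
    calc _ = ‖Complex.exp (x * Complex.I) - 1 - x * Complex.I‖ := by congr 1; ring
      _ ≤ x ^ 2 := h1
      _ ≤ _ := by nlinarith [sq_nonneg x]
  · have h1 : ‖(1 : ℂ) - Complex.exp (x * Complex.I)‖ ≤ |x| := by
      rw [norm_sub_rev, mul_comm]
      exact Real.norm_exp_I_mul_ofReal_sub_one_le
    calc _ = ‖((1 : ℂ) - Complex.exp (x * Complex.I)) + x * Complex.I‖ := by congr 1; ring
      _ ≤ |x| + |x| := (norm_add_le _ _).trans (add_le_add h1 (by simp))
      _ ≤ 2 * x ^ 2 := by rw [← sq_abs]; nlinarith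

theorem norm_compensated_integrand_le {V : Type*} [NormedAddCommGroup V] [InnerProductSpace ℝ V] (z v : V) :
    ‖1 + 2 * Real.pi * (inner ℝ z v : ℝ) * Complex.I - (Real.fourierChar (inner ℝ z v) : ℂ)‖
      ≤ 2 * (2 * Real.pi) ^ 2 * ‖v‖ ^ 2 * ‖z‖ ^ 2 := by
  have h1 := norm_one_add_I_sub_exp_le (2 * Real.pi * inner ℝ z v)
  rw [Real.fourierChar_apply]
  push_cast at h1 ⊢
  refine h1.trans ?_
  have h2 : (inner ℝ z v) ^ 2 ≤ (‖z‖ * ‖v‖) ^ 2 := by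
    rw [← sq_abs]
    exact pow_le_pow_left₀ (abs_nonneg _) (abs_real_inner_le_norm z v) 2
  rw [mul_pow]
  calc _ ≤ 2 * ((2 * Real.pi) ^ 2 * (‖z‖ * ‖v‖) ^ 2) := by gcongr
    _ = _ := by ring

variable [BorelSpace V] [FiniteDimensional ℝ V] {ρ : Measure V} {K : ℝ}

theorem integrable_compensated_integrand (hρ : Integrable (fun z => ‖z‖ ^ 2) ρ) (v : V) :
    Integrable (fun z => 1 + 2 * Real.pi * (inner ℝ z v : ℝ) * Complex.I
      - (Real.fourierChar (inner ℝ z v) : ℂ)) ρ := by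
  refine (hρ.const_mul (2 * (2 * Real.pi) ^ 2 * ‖v‖ ^ 2)).mono' ?_
    (Eventually.of_forall fun z => norm_compensated_integrand_le z v)
  simp only [Real.fourierChar_apply]
  fun_prop

/-- For a function `B` of linear growth, `v ↦ ∫ (1 - e^{-2πi L(z, v)}) B(z) ρ(dz)` is smooth when
the jumps are bounded: its derivative is the Fourier integral of an integrable function of
quadratic growth. -/
theorem contDiff_integral_sub_fourierChar_smul {F : Type*} [NormedAddCommGroup F] [NormedSpace ℂ F]
    [CompleteSpace F] (L : V →L[ℝ] V →L[ℝ] ℝ) (hL : ‖L‖ ≤ 1) {B : V → F} {b : ℝ} (hb : 0 ≤ b)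
    (hB : ∀ z, ‖B z‖ ≤ b * ‖z‖) (hBm : AEStronglyMeasurable B ρ)
    (hK : ∀ᵐ z ∂ρ, ‖z‖ ≤ K) (hρ : Integrable (fun z => ‖z‖ ^ 2) ρ) :
    (∀ v, Integrable (fun z => B z - Real.fourierChar (-L z v) • B z) ρ) ∧
    (∀ v z, ‖B z - Real.fourierChar (-L z v) • B z‖ ≤ 2 * Real.pi * b * ‖v‖ * ‖z‖ ^ 2) ∧
    (∀ n : ℕ, ContDiff ℝ n (fun v => ∫ z, (B z - Real.fourierChar (-L z v) • B z) ∂ρ)) ∧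
    ∀ (n : ℕ) v,
      ‖iteratedFDeriv ℝ (n + 1) (fun v => ∫ z, (B z - Real.fourierChar (-L z v) • B z) ∂ρ) v‖
        ≤ (2 * Real.pi) ^ (n + 1) * K ^ n * b * ∫ z, ‖z‖ ^ 2 ∂ρ := by
  let B₂ : V → (V →L[ℝ] F) := VectorFourier.fourierSMulRight L B
  have hB₂ : ∀ z, ‖B₂ z‖ ≤ 2 * Real.pi * b * ‖z‖ ^ 2 := fun z => by
    calc _ ≤ 2 * Real.pi * ‖L‖ * ‖z‖ * ‖B z‖ := VectorFourier.norm_fourierSMulRight_le L _ z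
      _ ≤ 2 * Real.pi * 1 * ‖z‖ * (b * ‖z‖) := by gcongr; exact hB z
      _ = _ := by ring
  have hB₂m : AEStronglyMeasurable B₂ ρ := AEStronglyMeasurable.fourierSMulRight (L := L) hBm
  have hem : ∀ v, AEStronglyMeasurable (fun z => Real.fourierChar (-L z v)) ρ := fun v =>
    (Real.continuous_fourierChar.comp (by fun_prop)).aestronglyMeasurable
  set D₁ : V → F := fun v => ∫ z, (B z - Real.fourierChar (-L z v) • B z) ∂ρ
  have hD₁le : ∀ v z, ‖B z - Real.fourierChar (-L z v) • B z‖
      ≤ 2 * Real.pi * b * ‖v‖ * ‖z‖ ^ 2 := fun v z => by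
    have h1 : B z - Real.fourierChar (-L z v) • B z
        = ((1 : ℂ) - Real.fourierChar (-L z v)) • B z := by
      rw [sub_smul, one_smul, Circle.smul_def]
    have h2 : |(-L z v)| ≤ ‖z‖ * ‖v‖ := by
      rw [abs_neg, ← Real.norm_eq_abs]
      calc _ ≤ ‖L‖ * ‖z‖ * ‖v‖ := L.le_opNorm₂ z v
        _ ≤ 1 * ‖z‖ * ‖v‖ := by gcongr
        _ = _ := by ring
    rw [h1, norm_smul]
    calc _ ≤ (2 * Real.pi * |(-L z v)|) * (b * ‖z‖) :=
          mul_le_mul (norm_one_sub_fourierChar_le _) (hB z) (norm_nonneg _) (by positivity)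
      _ ≤ (2 * Real.pi * (‖z‖ * ‖v‖)) * (b * ‖z‖) := by gcongr
      _ = _ := by ring
  have hD₁m : ∀ v, AEStronglyMeasurable (fun z => B z - Real.fourierChar (-L z v) • B z) ρ :=
    fun v => hBm.sub ((hem v).fun_smul hBm)
  have hD₁i : ∀ v, Integrable (fun z => B z - Real.fourierChar (-L z v) • B z) ρ := fun v =>
    (hρ.const_mul (2 * Real.pi * b * ‖v‖)).mono' (hD₁m v) (Eventually.of_forall (hD₁le v))
  have hD₁ : ∀ v, HasFDerivAt D₁
      (-VectorFourier.fourierIntegral Real.fourierChar ρ L.toLinearMap₁₂ B₂ v) v := by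
    intro v
    have h0 : -VectorFourier.fourierIntegral Real.fourierChar ρ L.toLinearMap₁₂ B₂ v
        = ∫ z, -(Real.fourierChar (-L z v) • B₂ z) ∂ρ := by
      rw [integral_neg]; rfl
    rw [h0]
    refine hasFDerivAt_integral_of_dominated_of_fderiv_le
      (F := fun v z => B z - Real.fourierChar (-L z v) • B z)
      (F' := fun v z => -(Real.fourierChar (-L z v) • B₂ z))
      (bound := fun z => 2 * Real.pi * b * ‖z‖ ^ 2)
      (Metric.ball_mem_nhds v one_pos) (Eventually.of_forall hD₁m)
      (hD₁i v) ((hem v).fun_smul hB₂m).neg ?_ (hρ.const_mul _) ?_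
    · refine Eventually.of_forall fun z w _ => ?_
      rw [norm_neg]
      exact (Circle.norm_smul _ (B₂ z)).le.trans (hB₂ z)
    · refine Eventually.of_forall fun z w _ => ?_
      exact (VectorFourier.hasFDerivAt_fourierChar_smul L B z w).const_sub (B z)
  have hmomle : ∀ n : ℕ, ∀ᵐ z ∂ρ, ‖z‖ ^ n * ‖B₂ z‖ ≤ K ^ n * (2 * Real.pi * b) * ‖z‖ ^ 2 := by
    intro n
    filter_upwards [hK] with z hz
    have hK0 : 0 ≤ K := (norm_nonneg z).trans hz
    calc _ ≤ K ^ n * (2 * Real.pi * b * ‖z‖ ^ 2) := by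
          have := hB₂ z
          gcongr
      _ = _ := by ring
  have hmom : ∀ n : ℕ, Integrable (fun z => ‖z‖ ^ n * ‖B₂ z‖) ρ := by
    intro n
    refine (hρ.const_mul (K ^ n * (2 * Real.pi * b))).mono' ?_ ?_
    · exact (by fun_prop : AEStronglyMeasurable (fun z : V => ‖z‖ ^ n) ρ).mul hB₂m.norm
    · filter_upwards [hmomle n] with z hz
      rwa [Real.norm_of_nonneg (by positivity)]
  have hf₂ : fderiv ℝ D₁
      = -VectorFourier.fourierIntegral Real.fourierChar ρ L.toLinearMap₁₂ B₂ :=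
    funext fun v => (hD₁ v).fderiv
  have hcd : ∀ n : ℕ, ContDiff ℝ n
      (VectorFourier.fourierIntegral Real.fourierChar ρ L.toLinearMap₁₂ B₂) := fun n =>
    VectorFourier.contDiff_fourierIntegral (N := n) L fun k _ => hmom k
  refine ⟨hD₁i, hD₁le, fun n => ?_, fun n v => ?_⟩
  · have h1 : ContDiff ℝ (n + 1) D₁ := by
      refine contDiff_succ_iff_fderiv.2 ⟨fun v => (hD₁ v).differentiableAt, by simp, ?_⟩
      rw [hf₂]
      exact (hcd n).neg
    exact h1.of_le (by norm_cast; omega)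
  · rw [← norm_iteratedFDeriv_fderiv, hf₂, iteratedFDeriv_neg_apply, norm_neg,
      VectorFourier.iteratedFDeriv_fourierIntegral (N := n) L (fun k _ => hmom k) hB₂m le_rfl]
    refine (VectorFourier.norm_fourierIntegral_le_integral_norm _ _ _ _ _).trans ?_
    have hle : ∀ᵐ z ∂ρ, ‖VectorFourier.fourierPowSMulRight L B₂ z n‖
        ≤ (2 * Real.pi) ^ (n + 1) * K ^ n * b * ‖z‖ ^ 2 := by
      filter_upwards [hmomle n] with z hz
      calc _ ≤ (2 * Real.pi * ‖L‖) ^ n * ‖z‖ ^ n * ‖B₂ z‖ :=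
            VectorFourier.norm_fourierPowSMulRight_le L B₂ z n
        _ ≤ (2 * Real.pi * 1) ^ n * (‖z‖ ^ n * ‖B₂ z‖) := by
            rw [mul_assoc]; gcongr
        _ ≤ (2 * Real.pi * 1) ^ n * (K ^ n * (2 * Real.pi * b) * ‖z‖ ^ 2) := by gcongr
        _ = _ := by ring
    rw [← integral_const_mul]
    exact integral_mono_of_nonneg (Eventually.of_forall fun z => norm_nonneg _)
      (hρ.const_mul _) hle

/-- The symbol is smooth when the jumps are bounded. Its first derivative grows at most linearly,
thanks to the compensation, and all higher derivatives are bounded. -/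
theorem contDiff_compensatedSymbol (hK : ∀ᵐ z ∂ρ, ‖z‖ ≤ K)
    (hρ : Integrable (fun z => ‖z‖ ^ 2) ρ) :
    (∀ n : ℕ, ContDiff ℝ n (compensatedSymbol ρ)) ∧
    (∀ v, ‖iteratedFDeriv ℝ 1 (compensatedSymbol ρ) v‖
      ≤ (2 * Real.pi) ^ 2 * (∫ z, ‖z‖ ^ 2 ∂ρ) * ‖v‖) ∧
    ∀ (n : ℕ) v, ‖iteratedFDeriv ℝ (n + 2) (compensatedSymbol ρ) v‖
      ≤ (2 * Real.pi) ^ (n + 2) * K ^ n * ∫ z, ‖z‖ ^ 2 ∂ρ := by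
  let L : V →L[ℝ] V →L[ℝ] ℝ := -innerSL ℝ
  have hL : ‖L‖ ≤ 1 := L.opNorm_le_bound₂ zero_le_one fun z v => by
    simpa [L, innerSL_apply_apply ℝ] using abs_real_inner_le_norm z v
  have hLz : ∀ z v, -L z v = inner ℝ z v := fun z v => by simp [L, innerSL_apply_apply ℝ]
  let B : V → (V →L[ℝ] ℂ) := VectorFourier.fourierSMulRight L (fun _ => (1 : ℂ))
  have hB : ∀ z, ‖B z‖ ≤ 2 * Real.pi * ‖z‖ := fun z => by
    calc _ ≤ 2 * Real.pi * ‖L‖ * ‖z‖ * ‖(1 : ℂ)‖ := VectorFourier.norm_fourierSMulRight_le L _ z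
      _ ≤ 2 * Real.pi * 1 * ‖z‖ * ‖(1 : ℂ)‖ := by gcongr
      _ = _ := by simp
  have hBm : AEStronglyMeasurable B ρ :=
    AEStronglyMeasurable.fourierSMulRight (L := L) aestronglyMeasurable_const
  obtain ⟨hD₁i, hD₁le, hcd, hbd⟩ := contDiff_integral_sub_fourierChar_smul L hL
    (by positivity) hB hBm hK hρ
  have hS : ∀ v, HasFDerivAt (compensatedSymbol ρ)
      (∫ z, (B z - Real.fourierChar (-L z v) • B z) ∂ρ) v := by
    intro v
    refine hasFDerivAt_integral_of_dominated_of_fderiv_le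
      (F := fun v z => 1 + 2 * Real.pi * (inner ℝ z v : ℝ) * Complex.I
        - (Real.fourierChar (inner ℝ z v) : ℂ))
      (F' := fun v z => B z - Real.fourierChar (-L z v) • B z)
      (bound := fun z => 2 * Real.pi * (2 * Real.pi) * (‖v‖ + 1) * ‖z‖ ^ 2)
      (Metric.ball_mem_nhds v one_pos)
      (Eventually.of_forall fun w => (integrable_compensated_integrand hρ w).1)
      (integrable_compensated_integrand hρ v) (hD₁i v).1 ?_ (hρ.const_mul _) ?_
    · refine Eventually.of_forall fun z w hw => (hD₁le w z).trans ?_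
      have : ‖w‖ ≤ ‖v‖ + 1 := by
        rw [mem_ball_iff_norm] at hw
        linarith [norm_sub_norm_le w v]
      gcongr
    · refine Eventually.of_forall fun z w _ => ?_
      have h1 := VectorFourier.hasFDerivAt_fourierChar_smul L (fun _ => (1 : ℂ)) z w
      have h2 : HasFDerivAt (fun w : V => 1 + 2 * Real.pi * (inner ℝ z w : ℝ) * Complex.I)
          (B z) w := by
        have h3 : (fun w : V => 1 + 2 * Real.pi * (inner ℝ z w : ℝ) * Complex.I)
            = fun w => 1 + B z w := by
          funext w
          simp only [B, VectorFourier.fourierSMulRight_apply, ← hLz, Complex.real_smul,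
            smul_eq_mul]
          push_cast; ring
        rw [h3]
        exact (B z).hasFDerivAt.const_add 1
      convert! h2.sub h1 using 1
      funext w
      simp [hLz, Circle.smul_def]
  have hf₁ : fderiv ℝ (compensatedSymbol ρ)
      = fun v => ∫ z, (B z - Real.fourierChar (-L z v) • B z) ∂ρ := funext fun v => (hS v).fderiv
  refine ⟨fun n => ?_, fun v => ?_, fun n v => ?_⟩
  · have h2 : ContDiff ℝ (n + 1) (compensatedSymbol ρ) := by
      refine contDiff_succ_iff_fderiv.2 ⟨fun v => (hS v).differentiableAt, by simp, ?_⟩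
      rw [hf₁]
      exact hcd n
    exact h2.of_le (by norm_cast; omega)
  · have h1 := norm_iteratedFDeriv_fderiv (𝕜 := ℝ) (f := compensatedSymbol ρ) (x := v) (n := 0)
    rw [zero_add] at h1
    rw [← h1, hf₁, norm_iteratedFDeriv_zero]
    refine (norm_integral_le_integral_norm _).trans ?_
    calc _ ≤ ∫ z, 2 * Real.pi * (2 * Real.pi) * ‖v‖ * ‖z‖ ^ 2 ∂ρ :=
          integral_mono (hD₁i v).norm (hρ.const_mul _) (hD₁le v)
      _ = _ := by rw [integral_const_mul]; ring
  · rw [show n + 2 = (n + 1) + 1 from rfl, ← norm_iteratedFDeriv_fderiv, hf₁]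
    refine (hbd n v).trans (le_of_eq ?_)
    ring

theorem continuous_compensatedSymbol (hK : ∀ᵐ z ∂ρ, ‖z‖ ≤ K)
    (hρ : Integrable (fun z => ‖z‖ ^ 2) ρ) : Continuous (compensatedSymbol ρ) :=
  ((contDiff_compensatedSymbol hK hρ).1 0).continuous

/-- Derivatives of `exp` over `ℝ`, as a map `ℂ → ℂ`. -/
theorem norm_iteratedFDeriv_cexp_le (n : ℕ) (x : ℂ) :
    ‖iteratedFDeriv ℝ n Complex.exp x‖ ≤ ‖Complex.exp x‖ := by
  induction n with
  | zero => simp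
  | succ n ih =>
    let Λ : ℂ →L[ℝ] (ℂ →L[ℝ] ℂ) := ContinuousLinearMap.mul ℝ ℂ
    have hΛ : ‖Λ‖ ≤ 1 := ContinuousLinearMap.opNorm_mul_le ℝ ℂ
    have h1 : fderiv ℝ Complex.exp = Λ ∘ Complex.exp := by
      funext y
      have h2 := ((Complex.hasDerivAt_exp y).hasFDerivAt.restrictScalars ℝ).fderiv
      rw [h2]
      ext; simp [Λ, mul_comm]
    rw [← norm_iteratedFDeriv_fderiv, h1]
    refine (Λ.norm_iteratedFDeriv_comp_left (N := n)
      (Complex.contDiff_exp.of_le le_top).contDiffAt le_rfl).trans ?_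
    calc _ ≤ 1 * ‖Complex.exp x‖ := by gcongr
      _ = _ := one_mul _

end SmoothSymbol

/-! ### `L¹` bounds for Fourier transforms of smooth functions -/

section FourierL1

open Module in
/-- If `f` has `dim V + 1` derivatives that are integrable with weight `1 + ‖v‖`, then
`𝓕 f` and its gradient are bounded by a multiple of the integrable function
`(1 + ‖w‖) ^ (-(dim V + 1))`. -/
theorem exists_lintegral_iteratedFDeriv_fourier_le (V : Type*) [NormedAddCommGroup V]
    [InnerProductSpace ℝ V] [MeasurableSpace V] [BorelSpace V] [FiniteDimensional ℝ V] (C : ℝ) :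
    ∃ c : ℝ, ∀ f : V → ℂ, ContDiff ℝ (finrank ℝ V + 1 : ℕ) f →
      (∀ k n : ℕ, k ≤ 1 → n ≤ finrank ℝ V + 1 →
        Integrable (fun v => ‖v‖ ^ k * ‖iteratedFDeriv ℝ n f v‖) ∧
        ∫ v, ‖v‖ ^ k * ‖iteratedFDeriv ℝ n f v‖ ≤ C) →
      ∀ k ≤ 1, ∫⁻ w, ‖iteratedFDeriv ℝ k (𝓕 f) w‖ₑ ≤ ENNReal.ofReal c := by
  set N := finrank ℝ V + 1 with hN
  -- `E` bounds every `‖w‖ ^ n * ‖D^k (𝓕 f) w‖` with `n ≤ N`, `k ≤ 1`: the estimate from Mathlib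
  -- is a sum of at most `2 (N + 1)` weighted norms, each at most `C`.
  set E : ℝ := 2 * Real.pi * 4 ^ N * ((2 * (N + 1) : ℕ) * C) with hE
  set g : V → ℝ := fun w => 2 ^ N * (2 * E) * (1 + ‖w‖) ^ (-(N : ℝ)) with hg
  have hgi : Integrable g := (integrable_one_add_norm (by simp [hN])).const_mul _
  refine ⟨∫ w, g w, fun f hf hbd k hk => ?_⟩
  have hC : 0 ≤ C := le_trans (integral_nonneg fun v => by positivity)
    (hbd 0 0 (by norm_num) (by omega)).2
  have hE0 : 0 ≤ E := by positivity
  have hdec : ∀ n ≤ N, ∀ w, ‖w‖ ^ n * ‖iteratedFDeriv ℝ k (𝓕 f) w‖ ≤ E := by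
    intro n hn w
    have h1 := Real.pow_mul_norm_iteratedFDeriv_fourier_le (K := 1) (N := N) hf
      (fun k n hk hn => (hbd k n (by exact_mod_cast hk) (by exact_mod_cast hn)).1)
      (k := k) (n := n) (by exact_mod_cast hk) (by exact_mod_cast hn) w
    refine h1.trans ?_
    have h2 : (2 * Real.pi) ^ k ≤ 2 * Real.pi := by
      have hpi := Real.pi_gt_three
      calc _ ≤ (2 * Real.pi) ^ 1 := pow_le_pow_right₀ (by linarith) hk
        _ = _ := pow_one _
    have h3 : ((2 : ℝ) * k + 2) ^ n ≤ 4 ^ N := by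
      have : (k : ℝ) ≤ 1 := by exact_mod_cast hk
      calc _ ≤ (4 : ℝ) ^ n := pow_le_pow_left₀ (by positivity) (by linarith) n
        _ ≤ _ := pow_le_pow_right₀ (by norm_num) hn
    have h4 : ∑ p ∈ Finset.range (k + 1) ×ˢ Finset.range (n + 1),
        ∫ v, ‖v‖ ^ p.1 * ‖iteratedFDeriv ℝ p.2 f v‖ ≤ (2 * (N + 1) : ℕ) * C := by
      refine (Finset.sum_le_card_nsmul _ _ C fun p hp => ?_).trans ?_
      · simp only [Finset.mem_product, Finset.mem_range] at hp
        exact (hbd _ _ (by omega) (by omega)).2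
      · rw [nsmul_eq_mul, Finset.card_product, Finset.card_range, Finset.card_range]
        gcongr
        omega
    have h5 : 0 ≤ ∑ p ∈ Finset.range (k + 1) ×ˢ Finset.range (n + 1),
        ∫ v, ‖v‖ ^ p.1 * ‖iteratedFDeriv ℝ p.2 f v‖ :=
      Finset.sum_nonneg fun p _ => integral_nonneg fun v => by positivity
    exact mul_le_mul (mul_le_mul h2 h3 (by positivity) (by positivity)) h4 h5 (by positivity)
  have hle : ∀ w, ‖iteratedFDeriv ℝ k (𝓕 f) w‖ ≤ g w := by
    intro w
    have h0 := hdec 0 (by omega) w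
    have h1 := hdec N le_rfl w
    rw [pow_zero, one_mul] at h0
    have h2 : (1 + ‖w‖) ^ N ≤ 2 ^ N * (1 + ‖w‖ ^ N) := by
      have := add_pow_le (zero_le_one) (norm_nonneg w) N
      rw [one_pow] at this
      refine this.trans ?_
      gcongr
      · norm_num
      · omega
    simp only [hg]
    rw [Real.rpow_neg (by positivity), Real.rpow_natCast, ← div_eq_mul_inv,
      le_div_iff₀ (by positivity)]
    calc _ ≤ ‖iteratedFDeriv ℝ k (𝓕 f) w‖ * (2 ^ N * (1 + ‖w‖ ^ N)) := by gcongr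
      _ = 2 ^ N * (‖iteratedFDeriv ℝ k (𝓕 f) w‖ + ‖w‖ ^ N * ‖iteratedFDeriv ℝ k (𝓕 f) w‖) := by
          ring
      _ ≤ 2 ^ N * (E + E) := by gcongr
      _ = _ := by ring
  rw [ofReal_integral_eq_lintegral_ofReal hgi (Eventually.of_forall fun w => by positivity)]
  refine lintegral_mono fun w => ?_
  rw [← ofReal_norm]
  exact ENNReal.ofReal_le_ofReal (hle w)

open Module in
/-- Uniform `L¹` bounds for the density with Fourier transform `exp (-S)`, where `S` is the
compensated symbol of `ρ`, and for its gradient: they depend only on the range of the jumps, the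
second moment of `ρ` and a weighted integral of `‖exp (-S)‖`. -/
theorem exists_lintegral_fourier_exp_compensatedSymbol_le (V : Type*) [NormedAddCommGroup V]
    [InnerProductSpace ℝ V] [MeasurableSpace V] [BorelSpace V] [FiniteDimensional ℝ V]
    (K M C : ℝ) :
    ∃ c : ℝ, ∀ ρ : Measure V, (∀ᵐ z ∂ρ, ‖z‖ ≤ K) → Integrable (fun z => ‖z‖ ^ 2) ρ →
      ∫ z, ‖z‖ ^ 2 ∂ρ ≤ M →
      ∫⁻ v, ENNReal.ofReal ((1 + ‖v‖) ^ (finrank ℝ V + 2)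
        * ‖Complex.exp (-compensatedSymbol ρ v)‖) ≤ ENNReal.ofReal C →
      ∀ k ≤ 1, ∫⁻ w, ‖iteratedFDeriv ℝ k
        (𝓕 fun v => Complex.exp (-compensatedSymbol ρ v)) w‖ₑ ≤ ENNReal.ofReal c := by
  set N := finrank ℝ V + 1 with hN
  -- a common base for the geometric bounds on all derivatives of the symbol
  set A : ℝ := (2 * Real.pi) ^ 2 * (1 + |K|) * (1 + |M|) with hA
  have hpi := Real.pi_gt_three
  have hA1 : 1 ≤ A := by
    have h1 : (1 : ℝ) ≤ (2 * Real.pi) ^ 2 := by nlinarith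
    have h2 : 1 ≤ 1 + |K| := by linarith [abs_nonneg K]
    have h3 : 1 ≤ 1 + |M| := by linarith [abs_nonneg M]
    nlinarith [mul_le_mul h1 h2 zero_le_one (by positivity)]
  obtain ⟨c, hc⟩ := exists_lintegral_iteratedFDeriv_fourier_le V (N.factorial * A ^ N * |C|)
  refine ⟨c, fun ρ hK hρ hM hint => hc _ ?_ ?_⟩
  · exact Complex.contDiff_exp.comp ((contDiff_compensatedSymbol hK hρ).1 _).neg
  obtain ⟨hcd, hd1, hd2⟩ := contDiff_compensatedSymbol hK hρ
  set S := compensatedSymbol ρ with hS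
  have hf : ContDiff ℝ N (fun v => Complex.exp (-S v)) := Complex.contDiff_exp.comp (hcd N).neg
  have hM0 : 0 ≤ ∫ z, ‖z‖ ^ 2 ∂ρ := integral_nonneg fun z => by positivity
  have hMM : ∫ z, ‖z‖ ^ 2 ∂ρ ≤ 1 + |M| := hM.trans (by linarith [le_abs_self M])
  have hder : ∀ v, ∀ i, 1 ≤ i → ‖iteratedFDeriv ℝ i (-S) v‖ ≤ (A * (1 + ‖v‖)) ^ i := by
    intro v i hi
    rw [iteratedFDeriv_neg_apply, norm_neg]
    obtain rfl | ⟨n, rfl⟩ : i = 1 ∨ ∃ n, i = n + 2 := by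
      rcases i with _ | _ | n
      · omega
      · exact Or.inl rfl
      · exact Or.inr ⟨n, rfl⟩
    · rw [pow_one]
      refine (hd1 v).trans ?_
      have h1 : (2 * Real.pi) ^ 2 * (∫ z, ‖z‖ ^ 2 ∂ρ) ≤ A := by
        calc _ ≤ (2 * Real.pi) ^ 2 * (1 + |M|) := by gcongr
          _ ≤ (2 * Real.pi) ^ 2 * (1 + |M|) * (1 + |K|) :=
            le_mul_of_one_le_right (by positivity) (by linarith [abs_nonneg K])
          _ = A := by rw [hA]; ring
      exact mul_le_mul h1 (by linarith) (norm_nonneg _) (by linarith)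
    · refine (hd2 n v).trans ?_
      have h1 : K ^ n ≤ (1 + |K|) ^ (n + 2) := by
        calc _ ≤ |K| ^ n := by rw [← abs_pow]; exact le_abs_self _
          _ ≤ (1 + |K|) ^ n := by gcongr; linarith
          _ ≤ _ := pow_le_pow_right₀ (by linarith [abs_nonneg K]) (by omega)
      have h2 : ∫ z, ‖z‖ ^ 2 ∂ρ ≤ (1 + |M|) ^ (n + 2) :=
        hMM.trans (le_self_pow₀ (by linarith [abs_nonneg M]) (by omega))
      have h3 : (2 * Real.pi) ^ (n + 2) ≤ ((2 * Real.pi) ^ 2) ^ (n + 2) := by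
        gcongr
        nlinarith
      have h4 : A ^ (n + 2) ≤ (A * (1 + ‖v‖)) ^ (n + 2) := by
        gcongr
        exact le_mul_of_one_le_right (by linarith) (by linarith [norm_nonneg v])
      refine le_trans ?_ h4
      have h5 : A ^ (n + 2) = ((2 * Real.pi) ^ 2) ^ (n + 2) * (1 + |K|) ^ (n + 2)
          * (1 + |M|) ^ (n + 2) := by rw [hA, mul_pow, mul_pow]
      rw [h5]
      calc _ ≤ (2 * Real.pi) ^ (n + 2) * (1 + |K|) ^ (n + 2) * ∫ z, ‖z‖ ^ 2 ∂ρ := by gcongr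
        _ ≤ _ := by gcongr
  have hbound : ∀ n ≤ N, ∀ v, ‖iteratedFDeriv ℝ n (fun v => Complex.exp (-S v)) v‖
      ≤ N.factorial * A ^ N * ((1 + ‖v‖) ^ N * ‖Complex.exp (-S v)‖) := by
    intro n hn v
    have h1 := norm_iteratedFDeriv_comp_le (n := n) (N := N) (Complex.contDiff_exp (𝕜 := ℝ))
      (hcd N).neg (by exact_mod_cast hn) v (fun i _ => norm_iteratedFDeriv_cexp_le i (-S v))
      (fun i hi _ => hder v i hi)
    refine h1.trans ?_
    have h2 : 1 ≤ A * (1 + ‖v‖) := by nlinarith [norm_nonneg v]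
    calc (n.factorial : ℝ) * ‖Complex.exp (-S v)‖ * (A * (1 + ‖v‖)) ^ n
        ≤ N.factorial * ‖Complex.exp (-S v)‖ * (A * (1 + ‖v‖)) ^ N := by
          gcongr
      _ = _ := by rw [mul_pow]; ring
  set W : V → ℝ := fun v => (1 + ‖v‖) ^ (finrank ℝ V + 2) * ‖Complex.exp (-S v)‖ with hW
  have hWc : Continuous W := by
    have : Continuous S := (hcd 0).continuous
    fun_prop
  have hW0 : ∀ v, 0 ≤ W v := fun v => by positivity
  have hWi : Integrable W := by
    refine ⟨hWc.aestronglyMeasurable, ?_⟩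
    rw [hasFiniteIntegral_iff_ofReal (Eventually.of_forall hW0)]
    exact hint.trans_lt ENNReal.ofReal_lt_top
  have hWle : ∫ v, W v ≤ |C| := by
    rw [integral_eq_lintegral_of_nonneg_ae (Eventually.of_forall hW0) hWc.aestronglyMeasurable]
    refine ENNReal.toReal_le_of_le_ofReal (abs_nonneg C) (hint.trans ?_)
    exact ENNReal.ofReal_le_ofReal (le_abs_self C)
  intro k n hk hn
  have hle : ∀ v, ‖v‖ ^ k * ‖iteratedFDeriv ℝ n (fun v => Complex.exp (-S v)) v‖
      ≤ N.factorial * A ^ N * W v := by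
    intro v
    have h1 : ‖v‖ ^ k ≤ 1 + ‖v‖ := by
      calc _ ≤ (1 + ‖v‖) ^ k := by gcongr; linarith
        _ ≤ (1 + ‖v‖) ^ 1 := pow_le_pow_right₀ (by linarith [norm_nonneg v]) hk
        _ = _ := pow_one _
    calc _ ≤ (1 + ‖v‖) * (N.factorial * A ^ N * ((1 + ‖v‖) ^ N * ‖Complex.exp (-S v)‖)) :=
          mul_le_mul h1 (hbound n hn v) (norm_nonneg _) (by positivity)
      _ = _ := by simp only [hW, hN]; ring
  have hi : Integrable (fun v => ‖v‖ ^ k *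
      ‖iteratedFDeriv ℝ n (fun v => Complex.exp (-S v)) v‖) := by
    refine (hWi.const_mul (N.factorial * A ^ N)).mono' ?_ (Eventually.of_forall fun v => ?_)
    · have := hf.continuous_iteratedFDeriv (m := n) (by exact_mod_cast hn)
      exact (by fun_prop : Continuous _).aestronglyMeasurable
    · rw [Real.norm_of_nonneg (by positivity)]
      exact hle v
  refine ⟨hi, (integral_mono hi (hWi.const_mul _) hle).trans ?_⟩
  rw [integral_const_mul]
  gcongr

end FourierL1

/-! ### Dilations, and densities with integrable gradient -/

section Scaling

variable {V : Type*} [NormedAddCommGroup V] [InnerProductSpace ℝ V] [MeasurableSpace V]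
  [BorelSpace V] [FiniteDimensional ℝ V]

open Module in
theorem lintegral_comp_smul_of_pos (u : V → ℝ≥0∞) {R : ℝ} (hR : 0 < R) :
    ∫⁻ x, u (R • x) = ENNReal.ofReal (R ^ finrank ℝ V)⁻¹ * ∫⁻ x, u x := by
  have h1 := lintegral_map_equiv (μ := (volume : Measure V)) u
    (Homeomorph.smul (isUnit_iff_ne_zero.2 hR.ne').unit).toMeasurableEquiv
  have h2 : Measure.map (R • ·) (volume : Measure V)
      = ENNReal.ofReal |(R ^ finrank ℝ V)⁻¹| • volume := Measure.map_addHaar_smul volume hR.ne'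
  calc ∫⁻ x, u (R • x) = ∫⁻ x, u x ∂(Measure.map (R • ·) (volume : Measure V)) := h1.symm
    _ = _ := by rw [h2, lintegral_smul_measure, abs_of_pos (by positivity), smul_eq_mul]

open Module in
theorem fourier_comp_inv_smul (f : V → ℂ) {R : ℝ} (hR : 0 < R) (x : V) :
    𝓕 (fun ξ => f (R⁻¹ • ξ)) x = (R ^ finrank ℝ V) • 𝓕 f (R • x) := by
  rw [Real.fourier_eq, Real.fourier_eq, ← Measure.integral_comp_inv_smul_of_nonneg _ _ hR.le]
  congr 1 with ξ
  rw [inner_smul_left, inner_smul_right]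
  congr 3
  simp [hR.ne']

/-- The `L¹` norm of `𝓕 f` is invariant under dilations of `f`. -/
theorem lintegral_fourier_comp_inv_smul (f : V → ℂ) {R : ℝ} (hR : 0 < R) :
    ∫⁻ x, ‖𝓕 (fun ξ => f (R⁻¹ • ξ)) x‖ₑ = ∫⁻ x, ‖𝓕 f x‖ₑ := by
  simp only [fourier_comp_inv_smul f hR, enorm_smul]
  rw [lintegral_const_mul' _ _ enorm_ne_top,
    lintegral_comp_smul_of_pos (fun x => ‖𝓕 f x‖ₑ) hR, ← mul_assoc,
    Real.enorm_of_nonneg (by positivity), ← ENNReal.ofReal_mul (by positivity),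
    mul_inv_cancel₀ (by positivity), ENNReal.ofReal_one, one_mul]

/-- A dilation of `f` by `R` multiplies the `L¹` norm of the gradient of `𝓕 f` by `R`. -/
theorem lintegral_fderiv_fourier_comp_inv_smul (f : V → ℂ) {R : ℝ} (hR : 0 < R)
    (hf : Differentiable ℝ (𝓕 f)) :
    ∫⁻ x, ‖fderiv ℝ (𝓕 (fun ξ => f (R⁻¹ • ξ))) x‖ₑ
      = ENNReal.ofReal R * ∫⁻ x, ‖fderiv ℝ (𝓕 f) x‖ₑ := by
  have h1 : 𝓕 (fun ξ => f (R⁻¹ • ξ))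
      = fun x => (R ^ Module.finrank ℝ V) • 𝓕 f (R • x) :=
    funext (fourier_comp_inv_smul f hR)
  have h2 : ∀ x, ‖fderiv ℝ (𝓕 (fun ξ => f (R⁻¹ • ξ))) x‖ₑ
      = ENNReal.ofReal (R ^ Module.finrank ℝ V * R) * ‖fderiv ℝ (𝓕 f) (R • x)‖ₑ := by
    intro x
    have h3 : DifferentiableAt ℝ (fun x => 𝓕 f (R • x)) x :=
      (hf (R • x)).comp x (differentiableAt_id.const_smul R)
    rw [h1, fderiv_fun_const_smul h3, fderiv_comp_smul, smul_smul, enorm_smul,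
      Real.enorm_of_nonneg (by positivity)]
  simp only [h2]
  rw [lintegral_const_mul' _ _ ENNReal.ofReal_ne_top,
    lintegral_comp_smul_of_pos (fun x => ‖fderiv ℝ (𝓕 f) x‖ₑ) hR, ← mul_assoc,
    ← ENNReal.ofReal_mul (by positivity)]
  congr 2
  field_simp

end Scaling

section Density

variable {V : Type*} [NormedAddCommGroup V] [InnerProductSpace ℝ V] [MeasurableSpace V]
  [BorelSpace V] [FiniteDimensional ℝ V]

theorem enorm_gradient {V : Type*} [NormedAddCommGroup V] [InnerProductSpace ℝ V]
    [FiniteDimensional ℝ V] (g : V → ℝ) (x : V) : ‖∇ g x‖ₑ = ‖fderiv ℝ g x‖ₑ := by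
  rw [← ofReal_norm, ← ofReal_norm, gradient, LinearIsometryEquiv.norm_map]

/-- If the law `μ` has, on the Fourier side, a factor `h` whose Fourier transform is integrable
and continuously differentiable, then `μ` has a `C¹` density, whose gradient is no larger in `L¹`
than that of `𝓕 h`. -/
theorem density_of_charFun_eq_mul (μ m : Measure V) [IsProbabilityMeasure μ]
    [IsProbabilityMeasure m] {h φ : V → ℂ} (hi : Integrable h)
    (hi' : Integrable fun v => ‖v‖ * ‖h v‖)
    (hφ : ∀ ξ, φ ξ = charFun μ ((2 * Real.pi) • ξ))
    (hmul : ∀ ξ, φ ξ = charFun m ((2 * Real.pi) • ξ) * h ξ)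
    (hF : ∫⁻ x, ‖𝓕 h x‖ₑ < ∞) :
    (∀ x, 0 ≤ (𝓕 φ x).re) ∧
    μ = volume.withDensity (fun x => ENNReal.ofReal (𝓕 φ x).re) ∧
    ContDiff ℝ 1 (fun x => (𝓕 φ x).re) ∧
    ∫⁻ x, ‖∇ (fun x => (𝓕 φ x).re) x‖ₑ ≤ ∫⁻ x, ‖fderiv ℝ (𝓕 h) x‖ₑ := by
  have hφ' : φ = fun ξ => charFun m ((2 * Real.pi) • ξ) • h ξ := funext hmul
  have hφc : Continuous φ := by
    rw [funext hφ]; fun_prop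
  have hle : ∀ ξ, ‖φ ξ‖ ≤ ‖h ξ‖ := fun ξ => by
    rw [hmul, norm_mul]
    exact mul_le_of_le_one_left (norm_nonneg _) (norm_charFun_le_one _)
  have hφi : Integrable φ := hi.mono hφc.aestronglyMeasurable (Eventually.of_forall hle)
  have hφi' : Integrable fun v => ‖v‖ * ‖φ v‖ := by
    refine hi'.mono (by fun_prop : Continuous _).aestronglyMeasurable
      (Eventually.of_forall fun v => ?_)
    rw [Real.norm_of_nonneg (by positivity), Real.norm_of_nonneg (by positivity)]
    exact mul_le_mul_of_nonneg_left (hle v) (norm_nonneg v)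
  have hGcd : ContDiff ℝ 1 (𝓕 φ) := by
    refine Real.contDiff_fourier (N := 1) fun n hn => ?_
    have hn' : n ≤ 1 := by exact_mod_cast hn
    interval_cases n
    · simpa using hφi.norm
    · simpa using hφi'
  have hGi : Integrable (𝓕 φ) := by
    refine ⟨hGcd.continuous.aestronglyMeasurable, ?_⟩
    rw [hasFiniteIntegral_iff_enorm, hφ']
    exact (lintegral_fourier_charFun_smul_le m hi).trans_lt hF
  obtain ⟨h0, hμ⟩ := density_of_integrable_fourier μ hφ hφi hGi
  refine ⟨h0, hμ, Complex.reCLM.contDiff.comp hGcd, ?_⟩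
  -- Differentiation on the space side is multiplication by a linear form on the Fourier side,
  -- so the gradient of `𝓕 φ` is again a convolution with `m`.
  have hsm : VectorFourier.fourierSMulRight (innerSL ℝ) φ
      = fun ξ => charFun m ((2 * Real.pi) • ξ) • VectorFourier.fourierSMulRight (innerSL ℝ) h ξ := by
    funext ξ
    ext w
    simp only [VectorFourier.fourierSMulRight_apply, hmul, smul_apply, smul_eq_mul,
      Complex.real_smul]
    ring
  have hhi : Integrable (VectorFourier.fourierSMulRight (innerSL ℝ) h) := by
    refine (hi'.const_mul (2 * Real.pi * ‖(innerSL ℝ : V →L[ℝ] V →L[ℝ] ℝ)‖)).mono'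
      hi.1.fourierSMulRight (Eventually.of_forall fun v => ?_)
    refine (VectorFourier.norm_fourierSMulRight_le _ h v).trans (le_of_eq ?_)
    ring
  calc ∫⁻ x, ‖∇ (fun x => (𝓕 φ x).re) x‖ₑ ≤ ∫⁻ x, ‖fderiv ℝ (𝓕 φ) x‖ₑ := by
        refine lintegral_mono fun x => ?_
        rw [enorm_gradient]
        have h1 : fderiv ℝ (fun x => (𝓕 φ x).re) x = Complex.reCLM.comp (fderiv ℝ (𝓕 φ) x) :=
          (Complex.reCLM.hasFDerivAt.comp x
            (hGcd.differentiable (by simp) x).hasFDerivAt).fderiv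
        rw [h1, ← ofReal_norm, ← ofReal_norm]
        refine ENNReal.ofReal_le_ofReal ((ContinuousLinearMap.opNorm_comp_le _ _).trans ?_)
        rw [Complex.reCLM_norm, one_mul]
    _ ≤ ∫⁻ x, ‖fderiv ℝ (𝓕 h) x‖ₑ := by
        rw [Real.fderiv_fourier hφi hφi', Real.fderiv_fourier hi hi', hsm]
        exact lintegral_fourier_charFun_smul_le m hhi

end Density

/-! ### The symbol controls the Lévy measure -/

section LevyMeasure

variable {d : ℕ} {ν : Measure (EuclideanSpace ℝ (Fin d))}

theorem IsLevyMeasure.integrable_min (hν : IsLevyMeasure ν) :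
    Integrable (fun z => min 1 (‖z‖ ^ 2)) ν := by
  refine ⟨(by fun_prop : Continuous _).aestronglyMeasurable, ?_⟩
  rw [hasFiniteIntegral_iff_ofReal (Eventually.of_forall fun z => by positivity)]
  exact hν.lintegral_lt_top

theorem IsLevyMeasure.integrable_symbol (hν : IsLevyMeasure ν) (ξ : EuclideanSpace ℝ (Fin d)) :
    Integrable (fun z => (1 + (if ‖z‖ ≤ 1 then ((inner ℝ ξ z : ℝ) : ℂ) * Complex.I else 0)
      - Complex.exp (Complex.I * ((inner ℝ ξ z : ℝ) : ℂ)))) ν := by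
  refine (hν.integrable_min.const_mul (2 * (1 + ‖ξ‖ ^ 2))).mono' ?_
    (Eventually.of_forall fun z => ?_)
  · refine Measurable.aestronglyMeasurable ?_
    refine Measurable.sub (measurable_const.add (Measurable.ite ?_ (by fun_prop) (by fun_prop)))
      (by fun_prop)
    exact measurableSet_le (by fun_prop) (by fun_prop)
  · rw [mul_comm Complex.I]
    split_ifs with hz
    · refine (norm_one_add_I_sub_exp_le _).trans ?_
      have h1 : (inner ℝ ξ z) ^ 2 ≤ (‖ξ‖ * ‖z‖) ^ 2 := by
        rw [← sq_abs]
        exact pow_le_pow_left₀ (abs_nonneg _) (abs_real_inner_le_norm ξ z) 2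
      rw [min_eq_right (by nlinarith [norm_nonneg z])]
      nlinarith [sq_nonneg ‖z‖]
    · rw [min_eq_left (by nlinarith), add_zero]
      have h1 : ‖Complex.exp (((inner ℝ ξ z : ℝ) : ℂ) * Complex.I)‖ = 1 :=
        Complex.norm_exp_ofReal_mul_I _
      calc _ ≤ ‖(1 : ℂ)‖ + ‖Complex.exp (((inner ℝ ξ z : ℝ) : ℂ) * Complex.I)‖ := norm_sub_le _ _
        _ ≤ _ := by rw [h1, norm_one]; nlinarith [sq_nonneg ‖ξ‖]

theorem re_symbol_integrand (ξ z : EuclideanSpace ℝ (Fin d)) :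
    (1 + (if ‖z‖ ≤ 1 then ((inner ℝ ξ z : ℝ) : ℂ) * Complex.I else 0)
      - Complex.exp (Complex.I * ((inner ℝ ξ z : ℝ) : ℂ))).re = 1 - Real.cos (inner ℝ ξ z) := by
  rw [mul_comm Complex.I, Complex.sub_re, Complex.exp_ofReal_mul_I_re]
  split_ifs <;> simp

theorem IsLevyMeasure.integrable_one_sub_cos (hν : IsLevyMeasure ν)
    (ξ : EuclideanSpace ℝ (Fin d)) :
    Integrable (fun z => 1 - Real.cos (inner ℝ ξ z)) ν := by
  have h := (hν.integrable_symbol ξ).re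
  refine h.congr (Eventually.of_forall fun z => ?_)
  exact re_symbol_integrand ξ z

theorem IsLevyMeasure.re_levySymbol (hν : IsLevyMeasure ν) (ξ : EuclideanSpace ℝ (Fin d)) :
    (levySymbol ν ξ).re = ∫ z, (1 - Real.cos (inner ℝ ξ z)) ∂ν := by
  have h := integral_re (hν.integrable_symbol ξ)
  rw [levySymbol]
  refine h.symm.trans (integral_congr_ae (Eventually.of_forall fun z => ?_))
  exact re_symbol_integrand ξ z

theorem one_sub_cos_nonneg (x : ℝ) : 0 ≤ 1 - Real.cos x := by linarith [Real.cos_le_one x]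

theorem IsLevyMeasure.bddAbove_re_levySymbol (hν : IsLevyMeasure ν) (η : ℝ) :
    BddAbove ((fun ξ => (levySymbol ν ξ).re) '' Metric.closedBall 0 η) := by
  refine ⟨2 * (1 + η ^ 2) * ∫ z, min 1 (‖z‖ ^ 2) ∂ν, ?_⟩
  rintro _ ⟨ξ, hξ, rfl⟩
  rw [mem_closedBall_zero_iff] at hξ
  dsimp only
  rw [hν.re_levySymbol, ← integral_const_mul]
  refine integral_mono (hν.integrable_one_sub_cos ξ) (hν.integrable_min.const_mul _) fun z => ?_
  have h1 := Real.one_sub_sq_div_two_le_cos (x := inner ℝ ξ z)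
  have h2 := Real.neg_one_le_cos (inner ℝ ξ z)
  have h3 : (inner ℝ ξ z) ^ 2 ≤ (η * ‖z‖) ^ 2 := by
    rw [← sq_abs]
    refine pow_le_pow_left₀ (abs_nonneg _) ((abs_real_inner_le_norm ξ z).trans ?_) 2
    gcongr
  dsimp only
  rcases min_cases (1 : ℝ) (‖z‖ ^ 2) with ⟨h, _⟩ | ⟨h, _⟩ <;> rw [h] <;>
    nlinarith [sq_nonneg η, sq_nonneg ‖z‖]

/-- Inside the ball of radius `Ξ(s)` the symbol is at most `1 / s`. -/
theorem IsLevyMeasure.re_levySymbol_le_of_norm_lt_levyXi (hν : IsLevyMeasure ν) {s : ℝ}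
    {ξ : EuclideanSpace ℝ (Fin d)} (hξ : ‖ξ‖ < levyXi ν s) : (levySymbol ν ξ).re ≤ 1 / s := by
  by_contra! hcon
  have h1 : levyXi ν s ≤ ‖ξ‖ := by
    refine csInf_le ⟨0, fun η hη => hη.1⟩ ⟨norm_nonneg ξ, hcon.le.trans ?_⟩
    exact le_csSup (hν.bddAbove_re_levySymbol _) ⟨ξ, by simp, rfl⟩
  exact absurd h1 (not_le.2 hξ)

theorem IsLevyMeasure.measure_norm_gt_lt_top (hν : IsLevyMeasure ν) {r : ℝ} (hr : 0 < r) :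
    ν {z | r < ‖z‖} < ∞ := by
  have h1 := hν.integrable_min.measure_ge_lt_top (ε := min 1 (r ^ 2)) (by positivity)
  refine (measure_mono fun z (hz : r < ‖z‖) => ?_).trans_lt h1
  show min 1 (r ^ 2) ≤ min 1 (‖z‖ ^ 2)
  gcongr

theorem measurableSet_norm_gt (r : ℝ) :
    MeasurableSet {z : EuclideanSpace ℝ (Fin d) | r < ‖z‖} :=
  measurableSet_lt measurable_const measurable_norm

theorem measurableSet_norm_le (r : ℝ) :
    MeasurableSet {z : EuclideanSpace ℝ (Fin d) | ‖z‖ ≤ r} :=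
  measurableSet_le measurable_norm measurable_const

theorem IsLevyMeasure.integrable_sq_restrict (hν : IsLevyMeasure ν) (r : ℝ) :
    Integrable (fun z => ‖z‖ ^ 2) (ν.restrict {z | ‖z‖ ≤ r}) := by
  refine (hν.integrable_min.restrict.const_mul (1 + r ^ 2)).mono'
    (by fun_prop : Continuous _).aestronglyMeasurable ?_
  refine (ae_restrict_iff' (measurableSet_norm_le r)).2 (Eventually.of_forall fun z hz => ?_)
  have hz' : ‖z‖ ^ 2 ≤ r ^ 2 := pow_le_pow_left₀ (norm_nonneg z) hz 2
  rw [Real.norm_of_nonneg (by positivity)]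
  rcases min_cases (1 : ℝ) (‖z‖ ^ 2) with ⟨h, _⟩ | ⟨h, _⟩ <;> rw [h] <;>
    nlinarith [sq_nonneg r, sq_nonneg ‖z‖]

/-- For `|a| ≥ 2` the average over the segment does not degenerate, whereas the pointwise value
`1 - cos a` vanishes on `2πℤ`. -/
theorem half_le_integral_one_sub_cos {a : ℝ} (ha : 2 ≤ |a|) :
    1 / 2 ≤ ∫ u in (0 : ℝ)..1, (1 - Real.cos (u * a)) := by
  have ha0 : a ≠ 0 := by
    rintro rfl
    norm_num at ha
  have h1 : ∫ u in (0 : ℝ)..1, (1 - Real.cos (u * a)) = 1 - a⁻¹ * Real.sin a := by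
    rw [intervalIntegral.integral_sub (by simp)
      ((by fun_prop : Continuous fun u : ℝ => Real.cos (u * a)).intervalIntegrable _ _)]
    rw [intervalIntegral.integral_comp_mul_right (fun x => Real.cos x) ha0]
    simp
  have h2 : |a⁻¹ * Real.sin a| ≤ 1 / 2 := by
    rw [abs_mul, abs_inv]
    calc _ ≤ (2 : ℝ)⁻¹ * 1 := by
          gcongr
          exact Real.abs_sin_le_one a
      _ = _ := by norm_num
  rw [h1]
  linarith [le_abs_self (a⁻¹ * Real.sin a)]

theorem inner_single (u : ℝ) (j : Fin d) (z : EuclideanSpace ℝ (Fin d)) :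
    inner ℝ (EuclideanSpace.single j u) z = u * z j := by
  simp [EuclideanSpace.inner_single_left]

/-- A bound for the symbol on a ball controls the number of jumps in a coordinate direction, by
averaging the symbol over a segment. -/
theorem IsLevyMeasure.measure_abs_coord_ge_le (hν : IsLevyMeasure ν) {R b r : ℝ} (hR : 0 < R)
    (hb : ∀ ξ, ‖ξ‖ ≤ R → (levySymbol ν ξ).re ≤ b) (hr : 0 < r) (j : Fin d) :
    (ν.restrict {z | r < ‖z‖}).real {z | 2 ≤ |R * z j|} ≤ 2 * b := by
  set μ := ν.restrict {z | r < ‖z‖} with hμ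
  have : IsFiniteMeasure μ := isFiniteMeasure_restrict.2 (hν.measure_norm_gt_lt_top hr).ne
  have hvol : IsFiniteMeasure (volume.restrict (Set.uIoc (0 : ℝ) 1)) := by
    rw [Set.uIoc_of_le zero_le_one]; infer_instance
  have hI : Integrable (Function.uncurry fun (u : ℝ) (z : EuclideanSpace ℝ (Fin d)) =>
      1 - Real.cos (u * (R * z j))) ((volume.restrict (Set.uIoc 0 1)).prod μ) := by
    refine (integrable_const (2 : ℝ)).mono' ?_ (Eventually.of_forall fun p => ?_)
    · refine Continuous.aestronglyMeasurable ?_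
      simp only [Function.uncurry_def]
      fun_prop
    · simp only [Function.uncurry_def]
      rw [Real.norm_of_nonneg (one_sub_cos_nonneg _)]
      linarith [Real.neg_one_le_cos (p.1 * (R * p.2 j))]
  have hswap := intervalIntegral_integral_swap hI
  set G : EuclideanSpace ℝ (Fin d) → ℝ :=
    fun z => ∫ u in (0 : ℝ)..1, (1 - Real.cos (u * (R * z j))) with hG
  have hG0 : ∀ z, 0 ≤ G z := fun z =>
    intervalIntegral.integral_nonneg zero_le_one fun u _ => one_sub_cos_nonneg _
  have hGi : Integrable G μ := by
    have h1 := hI.integral_prod_right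
    refine h1.congr (Eventually.of_forall fun z => ?_)
    simp only [hG, Function.uncurry_def]
    rw [intervalIntegral.integral_of_le zero_le_one, Set.uIoc_of_le zero_le_one]
  have hA : MeasurableSet {z : EuclideanSpace ℝ (Fin d) | 2 ≤ |R * z j|} :=
    measurableSet_le measurable_const (by fun_prop)
  have hle : (1 / 2) * μ.real {z | 2 ≤ |R * z j|} ≤ ∫ z, G z ∂μ := by
    have h1 : ∫ z in {z | 2 ≤ |R * z j|}, (1 / 2 : ℝ) ∂μ ≤ ∫ z in {z | 2 ≤ |R * z j|}, G z ∂μ :=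
      setIntegral_mono_on (integrable_const _).integrableOn hGi.integrableOn hA
        fun z hz => half_le_integral_one_sub_cos hz
    have h2 := setIntegral_le_integral (s := {z | 2 ≤ |R * z j|}) hGi (Eventually.of_forall hG0)
    rw [setIntegral_const, smul_eq_mul, mul_comm] at h1
    exact h1.trans h2
  have hup : ‖∫ u in (0 : ℝ)..1, ∫ z, (1 - Real.cos (u * (R * z j))) ∂μ‖ ≤ b * |(1 : ℝ) - 0| := by
    refine intervalIntegral.norm_integral_le_of_norm_le_const fun u hu => ?_
    rw [Set.uIoc_of_le zero_le_one] at hu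
    rw [Real.norm_of_nonneg (integral_nonneg fun z => one_sub_cos_nonneg _)]
    refine le_trans ?_ (hb (EuclideanSpace.single j (u * R)) ?_)
    · rw [hν.re_levySymbol]
      have h1 := setIntegral_le_integral (s := {z | r < ‖z‖})
        (hν.integrable_one_sub_cos (EuclideanSpace.single j (u * R)))
        (Eventually.of_forall fun z => one_sub_cos_nonneg _)
      refine le_trans (le_of_eq ?_) h1
      simp only [inner_single, mul_assoc, hμ]
    · rw [PiLp.norm_single, Real.norm_of_nonneg (by have := hu.1.le; positivity)]
      nlinarith [hu.2]
  have hfin : ∫ z, G z ∂μ ≤ b := by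
    rw [← hswap]
    refine (le_abs_self _).trans (hup.trans ?_)
    simp
  linarith

theorem exists_coord_ge (hd : 1 ≤ d) {c : ℝ} {z : EuclideanSpace ℝ (Fin d)} (hz : d * c ≤ ‖z‖) :
    ∃ j, c ≤ |z j| := by
  by_contra! hcon
  have h1 : ‖z‖ ≤ ∑ j, |z j| := by
    have h2 := (EuclideanSpace.basisFun (Fin d) ℝ).sum_repr z
    calc ‖z‖ = ‖∑ j, z j • EuclideanSpace.basisFun (Fin d) ℝ j‖ := by
          conv_lhs => rw [← h2]
          simp
      _ ≤ ∑ j, ‖z j • EuclideanSpace.basisFun (Fin d) ℝ j‖ := norm_sum_le _ _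
      _ = _ := by simp [norm_smul]
  have h3 : ∑ j, |z j| < ∑ _j : Fin d, c :=
    Finset.sum_lt_sum_of_nonempty ⟨⟨0, hd⟩, Finset.mem_univ _⟩ fun j _ => hcon j
  simp at h3
  linarith

/-- A bound `b` for the symbol on the ball of radius `R` controls the mass of the jumps larger
than `2 d / R`. -/
theorem IsLevyMeasure.measure_norm_gt_le (hν : IsLevyMeasure ν) (hd : 1 ≤ d) {R b : ℝ}
    (hR : 0 < R) (hb : ∀ ξ, ‖ξ‖ ≤ R → (levySymbol ν ξ).re ≤ b) :
    ν.real {z | 2 * d / R < ‖z‖} ≤ 2 * d * b := by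
  have hd' : (0 : ℝ) < d := by exact_mod_cast hd
  have hr : 0 < 2 * d / R := by positivity
  set μ := ν.restrict {z | 2 * d / R < ‖z‖} with hμ
  have : IsFiniteMeasure μ := isFiniteMeasure_restrict.2 (hν.measure_norm_gt_lt_top hr).ne
  have h1 : {z | 2 * d / R < ‖z‖} ⊆ ⋃ j, {z : EuclideanSpace ℝ (Fin d) | 2 ≤ |R * z j|} := by
    intro z (hz : 2 * d / R < ‖z‖)
    obtain ⟨j, hj⟩ := exists_coord_ge hd (c := 2 / R) (z := z)
      (le_trans (le_of_eq (by ring)) hz.le)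
    refine Set.mem_iUnion.2 ⟨j, ?_⟩
    show 2 ≤ |R * z j|
    rw [abs_mul, abs_of_pos hR]
    rwa [div_le_iff₀' hR] at hj
  have h2 : ν.real {z | 2 * d / R < ‖z‖} = μ.real {z | 2 * d / R < ‖z‖} := by
    rw [measureReal_def, measureReal_def, hμ, Measure.restrict_apply_self]
  rw [h2]
  calc _ ≤ μ.real (⋃ j, {z : EuclideanSpace ℝ (Fin d) | 2 ≤ |R * z j|}) := measureReal_mono h1
    _ ≤ ∑ j, μ.real {z : EuclideanSpace ℝ (Fin d) | 2 ≤ |R * z j|} :=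
        measureReal_iUnion_fintype_le _
    _ ≤ ∑ _j : Fin d, 2 * b := Finset.sum_le_sum fun j _ =>
        hν.measure_abs_coord_ge_le hR hb hr j
    _ = _ := by simp; ring

/-- A bound `b` for the symbol on the ball of radius `R` controls the second moment of the jumps
of size at most `r`, as long as `R * r ≤ 1`. -/
theorem IsLevyMeasure.integral_sq_le (hν : IsLevyMeasure ν) {R b r : ℝ}
    (hR : 0 < R) (hb : ∀ ξ, ‖ξ‖ ≤ R → (levySymbol ν ξ).re ≤ b) (hr : R * r ≤ 1) :
    ∫ z in {z | ‖z‖ ≤ r}, ‖z‖ ^ 2 ∂ν ≤ 5 * d * b / R ^ 2 := by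
  have hpi := Real.pi_gt_three
  have hpi' := Real.pi_lt_d2
  have h5 : (1 / 5 : ℝ) ≤ 2 / Real.pi ^ 2 := by
    rw [div_le_div_iff₀ (by norm_num) (by positivity)]
    nlinarith
  have hcoord : ∀ j, Integrable (fun z : EuclideanSpace ℝ (Fin d) => (z j) ^ 2)
      (ν.restrict {z | ‖z‖ ≤ r}) := by
    intro j
    refine (hν.integrable_sq_restrict r).mono' (by fun_prop : Continuous _).aestronglyMeasurable
      (Eventually.of_forall fun z => ?_)
    rw [Real.norm_of_nonneg (by positivity), ← sq_abs]
    exact pow_le_pow_left₀ (abs_nonneg _) (PiLp.norm_apply_le z j) 2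
  have hj : ∀ j, ∫ z in {z | ‖z‖ ≤ r}, (z j) ^ 2 ∂ν ≤ 5 * b / R ^ 2 := by
    intro j
    have h1 : ∫ z in {z | ‖z‖ ≤ r}, (R ^ 2 / 5) * (z j) ^ 2 ∂ν
        ≤ ∫ z in {z | ‖z‖ ≤ r}, (1 - Real.cos (inner ℝ (EuclideanSpace.single j R) z)) ∂ν := by
      refine setIntegral_mono_on ((hcoord j).const_mul _)
        (hν.integrable_one_sub_cos _).integrableOn (measurableSet_norm_le r) fun z hz => ?_
      rw [inner_single]
      have h2 : |R * z j| ≤ 1 := by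
        rw [abs_mul, abs_of_pos hR]
        refine le_trans ?_ hr
        gcongr
        exact (PiLp.norm_apply_le z j).trans hz
      have h4 := Real.cos_le_one_sub_mul_cos_sq (x := R * z j) (by linarith)
      nlinarith [mul_le_mul_of_nonneg_right h5 (sq_nonneg (R * z j))]
    have h2 := setIntegral_le_integral (s := {z | ‖z‖ ≤ r})
      (hν.integrable_one_sub_cos (EuclideanSpace.single j R))
      (Eventually.of_forall fun z => one_sub_cos_nonneg _)
    have h3 := hb (EuclideanSpace.single j R)
      (by rw [PiLp.norm_single, Real.norm_of_nonneg hR.le])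
    rw [hν.re_levySymbol] at h3
    rw [integral_const_mul] at h1
    rw [le_div_iff₀ (by positivity)]
    linarith
  calc ∫ z in {z | ‖z‖ ≤ r}, ‖z‖ ^ 2 ∂ν = ∫ z in {z | ‖z‖ ≤ r}, ∑ j, (z j) ^ 2 ∂ν := by
        congr 1 with z
        rw [EuclideanSpace.real_norm_sq_eq]
    _ = ∑ j, ∫ z in {z | ‖z‖ ≤ r}, (z j) ^ 2 ∂ν := integral_finsetSum _ fun j _ => hcoord j
    _ ≤ ∑ _j : Fin d, 5 * b / R ^ 2 := Finset.sum_le_sum fun j _ => hj j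
    _ = _ := by simp; ring

end LevyMeasure

/-! ### Splitting off the large jumps -/

section Decomposition

variable {d : ℕ} {ν : Measure (EuclideanSpace ℝ (Fin d))}

/-- Moving the truncation of the compensator from `1` to `r` changes it by an integrable drift. -/
theorem IsLevyMeasure.integrable_drift (hν : IsLevyMeasure ν) {r : ℝ} (hr : 0 < r) :
    Integrable (fun z : EuclideanSpace ℝ (Fin d) =>
      ((if ‖z‖ ≤ 1 then (1 : ℝ) else 0) - if ‖z‖ ≤ r then 1 else 0) • z) ν := by
  refine (hν.integrable_min.const_mul ((1 + r) * (1 + 1 / r ^ 2))).mono' ?_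
    (Eventually.of_forall fun z => ?_)
  · refine Measurable.aestronglyMeasurable (Measurable.fun_smul (Measurable.fun_sub ?_ ?_) measurable_id)
    · exact Measurable.ite (measurableSet_norm_le 1) measurable_const measurable_const
    · exact Measurable.ite (measurableSet_norm_le r) measurable_const measurable_const
  · have h0 : 0 ≤ (1 + r) * (1 + 1 / r ^ 2) * min 1 (‖z‖ ^ 2) := by positivity
    rw [norm_smul]
    split_ifs with h1 h2 h2
    · simpa using h0
    · have h3 : 1 ≤ (1 / r ^ 2) * ‖z‖ ^ 2 := by
        rw [one_div, inv_mul_eq_div, one_le_div (by positivity)]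
        exact pow_le_pow_left₀ hr.le (not_le.1 h2).le 2
      rw [min_eq_right (by nlinarith [norm_nonneg z])]
      norm_num
      rw [one_div] at h3
      nlinarith [sq_nonneg ‖z‖]
    · rw [min_eq_left (by nlinarith [not_le.1 h1])]
      have h3 : 0 ≤ 1 / r ^ 2 := by positivity
      norm_num
      rw [one_div] at h3
      nlinarith
    · simpa using h0

/-- Splitting off the jumps larger than `r`: what remains of the symbol is the compensated symbol
of the small jumps, up to a compound Poisson exponent and a drift. -/
theorem IsLevyMeasure.levySymbol_eq_add (hν : IsLevyMeasure ν) {r : ℝ} (hr : 0 < r)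
    (ξ : EuclideanSpace ℝ (Fin d)) :
    levySymbol ν ((2 * Real.pi) • ξ) = compensatedSymbol (ν.restrict {z | ‖z‖ ≤ r}) ξ
      + (((ν.restrict {z | r < ‖z‖}).real Set.univ : ℂ)
        - charFun (ν.restrict {z | r < ‖z‖}) ((2 * Real.pi) • ξ))
      + (inner ℝ ((2 * Real.pi) • ξ)
        (∫ z, ((if ‖z‖ ≤ 1 then (1 : ℝ) else 0) - if ‖z‖ ≤ r then 1 else 0) • z ∂ν) : ℝ)
          * Complex.I := by
  set η := (2 * Real.pi) • ξ with hη
  set w : EuclideanSpace ℝ (Fin d) → EuclideanSpace ℝ (Fin d) := fun z =>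
    ((if ‖z‖ ≤ 1 then (1 : ℝ) else 0) - if ‖z‖ ≤ r then 1 else 0) • z with hw
  have hwi : Integrable w ν := hν.integrable_drift hr
  have hfin : IsFiniteMeasure (ν.restrict {z | r < ‖z‖}) :=
    isFiniteMeasure_restrict.2 (hν.measure_norm_gt_lt_top hr).ne
  have h1i := integrable_compensated_integrand (hν.integrable_sq_restrict r) ξ
  have h2i : Integrable (fun z => (1 : ℂ) - Complex.exp ((inner ℝ z η : ℝ) * Complex.I))
      (ν.restrict {z | r < ‖z‖}) := by
    refine (integrable_const (1 : ℂ)).sub ?_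
    exact (integrable_const (1 : ℝ)).mono (by fun_prop) (by simp)
  have h3i : Integrable (fun z => ((inner ℝ η (w z) : ℝ) : ℂ) * Complex.I) ν :=
    ((hwi.const_inner η).ofReal (𝕜 := ℂ)).mul_const _
  have e2 : ((ν.restrict {z | r < ‖z‖}).real Set.univ : ℂ)
      - charFun (ν.restrict {z | r < ‖z‖}) η
      = ∫ z in {z | r < ‖z‖}, (1 - Complex.exp ((inner ℝ z η : ℝ) * Complex.I)) ∂ν := by
    rw [integral_sub (integrable_const (1 : ℂ))
      ((integrable_const (1 : ℝ)).mono (by fun_prop) (by simp)), charFun_apply]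
    simp
  have e3 : ((inner ℝ η (∫ z, w z ∂ν) : ℝ) : ℂ) * Complex.I
      = ∫ z, ((inner ℝ η (w z) : ℝ) : ℂ) * Complex.I ∂ν := by
    rw [integral_mul_const, integral_complex_ofReal, integral_inner hwi]
  rw [e2, e3, compensatedSymbol, ← integral_indicator (measurableSet_norm_le r),
    ← integral_indicator (measurableSet_norm_gt r), ← integral_add, ← integral_add, levySymbol]
  · refine integral_congr_ae (Eventually.of_forall fun z => ?_)
    have hin : (inner ℝ η z : ℝ) = 2 * Real.pi * inner ℝ z ξ := by
      rw [hη, inner_smul_left, real_inner_comm]; simp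
    have hin' : (inner ℝ z η : ℝ) = 2 * Real.pi * inner ℝ z ξ := by
      rw [← hin, real_inner_comm]
    simp only [hw, inner_smul_right, hin, hin', Real.fourierChar_apply, Set.indicator_apply,
      Set.mem_ofPred_eq]
    rcases le_or_gt ‖z‖ r with h | h
    · simp only [if_pos h, if_neg (not_lt.2 h)]
      rw [mul_comm Complex.I]
      split_ifs <;> push_cast <;> ring
    · simp only [if_neg (not_le.2 h), if_pos h]
      rw [mul_comm Complex.I]
      split_ifs <;> push_cast <;> ring
  · exact ((integrable_indicator_iff (measurableSet_norm_le r)).2 h1i).add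
      ((integrable_indicator_iff (measurableSet_norm_gt r)).2 h2i)
  · exact h3i
  · exact (integrable_indicator_iff (measurableSet_norm_le r)).2 h1i
  · exact (integrable_indicator_iff (measurableSet_norm_gt r)).2 h2i

/-- The law with symbol `Ψ` at time `s` is the convolution of a probability law, collecting the
drift and the jumps larger than `r`, with a factor given by the small jumps. -/
theorem IsLevyMeasure.exists_charFun_mul (hν : IsLevyMeasure ν) {r : ℝ} (hr : 0 < r) {s : ℝ}
    (hs : 0 ≤ s) :
    ∃ m : Measure (EuclideanSpace ℝ (Fin d)), IsProbabilityMeasure m ∧ ∀ ξ,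
      Complex.exp (-(s * levySymbol ν ((2 * Real.pi) • ξ))) = charFun m ((2 * Real.pi) • ξ)
        * Complex.exp (-(s * compensatedSymbol (ν.restrict {z | ‖z‖ ≤ r}) ξ)) := by
  have hfin : IsFiniteMeasure (ν.restrict {z | r < ‖z‖}) :=
    isFiniteMeasure_restrict.2 (hν.measure_norm_gt_lt_top hr).ne
  set μ := ν.restrict {z | r < ‖z‖} with hμ
  set b := ∫ z, ((if ‖z‖ ≤ 1 then (1 : ℝ) else 0) - if ‖z‖ ≤ r then 1 else 0) • z ∂ν with hb
  have hfin' : IsFiniteMeasure (ENNReal.ofReal s • μ) := Measure.smul_finite _ ENNReal.ofReal_ne_top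
  obtain ⟨m, hm, hchar⟩ := exists_compoundPoisson (ENNReal.ofReal s • μ)
  refine ⟨m ∗ Measure.dirac (-(s • b)), inferInstance, fun ξ => ?_⟩
  have h1 : charFun (ENNReal.ofReal s • μ) ((2 * Real.pi) • ξ)
      = s * charFun μ ((2 * Real.pi) • ξ) := by
    rw [charFun_apply, charFun_apply, integral_smul_measure, ENNReal.toReal_ofReal hs,
      Complex.real_smul]
  have h2 : (ENNReal.ofReal s • μ).real Set.univ = s * μ.real Set.univ := by
    rw [measureReal_ennreal_smul_apply, ENNReal.toReal_ofReal hs]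
  rw [charFun_conv, hchar, charFun_dirac, h1, h2, ← Complex.exp_add, ← Complex.exp_add,
    hν.levySymbol_eq_add hr]
  have h3 : inner ℝ (-(s • b)) ((2 * Real.pi) • ξ) = -(s * inner ℝ ((2 * Real.pi) • ξ) b) := by
    rw [inner_neg_left, real_inner_smul_left, real_inner_comm]
  rw [h3]
  congr 1
  push_cast
  ring

end Decomposition

/-! ### The uniform estimate for the small jumps -/

section SmallJumps

variable {d : ℕ} {ν : Measure (EuclideanSpace ℝ (Fin d))}

/-- Removing the jumps larger than `r` lowers the real part of the symbol by at most twice their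
mass. -/
theorem IsLevyMeasure.re_levySymbol_le (hν : IsLevyMeasure ν) {r : ℝ} (hr : 0 < r)
    (ξ : EuclideanSpace ℝ (Fin d)) :
    (levySymbol ν ((2 * Real.pi) • ξ)).re
      ≤ (compensatedSymbol (ν.restrict {z | ‖z‖ ≤ r}) ξ).re + 2 * ν.real {z | r < ‖z‖} := by
  have hfin : IsFiniteMeasure (ν.restrict {z | r < ‖z‖}) :=
    isFiniteMeasure_restrict.2 (hν.measure_norm_gt_lt_top hr).ne
  have h1 : (ν.restrict {z | r < ‖z‖}).real Set.univ = ν.real {z | r < ‖z‖} := by simp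
  have h2 := (Complex.abs_re_le_norm _).trans
    (norm_charFun_le (μ := ν.restrict {z | r < ‖z‖}) ((2 * Real.pi) • ξ))
  rw [h1] at h2
  rw [hν.levySymbol_eq_add hr, h1]
  simp only [Complex.add_re, Complex.sub_re, Complex.ofReal_re, Complex.re_ofReal_mul,
    Complex.I_re, mul_zero, add_zero]
  linarith [neg_abs_le (charFun (ν.restrict {z | r < ‖z‖}) ((2 * Real.pi) • ξ)).re]

/-- The jump measure `σ` seen over the time `s` and in units of `1 / R`: jumps are multiplied by `R`
and their intensity by `s`. -/
noncomputable def rescaledJumps (σ : Measure (EuclideanSpace ℝ (Fin d))) (s R : ℝ) :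
    Measure (EuclideanSpace ℝ (Fin d)) :=
  ENNReal.ofReal s • σ.map (R • ·)

theorem compensatedSymbol_rescaledJumps (σ : Measure (EuclideanSpace ℝ (Fin d))) {s : ℝ}
    (hs : 0 ≤ s) (R : ℝ) (v : EuclideanSpace ℝ (Fin d)) :
    compensatedSymbol (rescaledJumps σ s R) v = s * compensatedSymbol σ (R • v) := by
  have hm : AEMeasurable (fun z : EuclideanSpace ℝ (Fin d) => R • z) σ :=
    (measurable_const_smul R).aemeasurable
  rw [compensatedSymbol, rescaledJumps, integral_smul_measure, integral_map hm,
    ENNReal.toReal_ofReal hs, Complex.real_smul, compensatedSymbol]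
  · simp only [real_inner_smul_left, real_inner_smul_right]
  · simp only [Real.fourierChar_apply]
    fun_prop

/-- Replaces the weight `‖v‖ ^ n` by `(1 + ‖v‖) ^ n`, at the cost of the volume of the unit ball. -/
theorem lintegral_one_add_norm_pow_mul_le (n : ℕ) (u : EuclideanSpace ℝ (Fin d) → ℝ)
    (hu0 : ∀ v, 0 ≤ u v) (hu1 : ∀ v, u v ≤ 1) :
    ∫⁻ v, ENNReal.ofReal ((1 + ‖v‖) ^ n * u v) ≤ ENNReal.ofReal (2 ^ n) *
      (volume (Metric.closedBall (0 : EuclideanSpace ℝ (Fin d)) 1)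
        + ∫⁻ v, ENNReal.ofReal (u v * ‖v‖ ^ n)) := by
  rw [← lintegral_indicator_one Metric.isClosed_closedBall.measurableSet,
    ← lintegral_add_left (measurable_one.indicator Metric.isClosed_closedBall.measurableSet),
    ← lintegral_const_mul' _ _ ENNReal.ofReal_ne_top]
  refine lintegral_mono fun v => ?_
  by_cases hv : ‖v‖ ≤ 1
  · have hv' : v ∈ Metric.closedBall (0 : EuclideanSpace ℝ (Fin d)) 1 := by simpa using hv
    rw [Set.indicator_of_mem hv', Pi.one_apply]
    calc ENNReal.ofReal ((1 + ‖v‖) ^ n * u v) ≤ ENNReal.ofReal (2 ^ n) := by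
          refine ENNReal.ofReal_le_ofReal ?_
          calc (1 + ‖v‖) ^ n * u v ≤ 2 ^ n * 1 := by
                gcongr
                · exact hu0 v
                · linarith
                · exact hu1 v
            _ = _ := mul_one _
      _ ≤ _ := le_mul_of_one_le_right zero_le (le_add_of_nonneg_right zero_le)
  · refine le_trans ?_ (mul_le_mul_right (le_add_of_nonneg_left zero_le) _)
    rw [← ENNReal.ofReal_mul (by positivity)]
    refine ENNReal.ofReal_le_ofReal ?_
    have h1 : (1 + ‖v‖) ^ n ≤ 2 ^ n * ‖v‖ ^ n := by
      rw [← mul_pow]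
      gcongr
      linarith
    calc _ ≤ 2 ^ n * ‖v‖ ^ n * u v := by gcongr; exact hu0 v
      _ = _ := by ring

/-- The uniform estimate for the small jumps: at the scale `1 / R`, where `s Re Ψ ≤ 1` on the ball
of radius `R`, the rescaled small-jump density has `L¹` bounds which do not depend on `s`. -/
theorem exists_smallJumps_bound (hd : 1 ≤ d) (C₁ : ℝ) : ∃ c : ℝ,
    ∀ ν : Measure (EuclideanSpace ℝ (Fin d)), IsLevyMeasure ν → ∀ s R : ℝ, 0 < s → 0 < R →
    (∀ ξ, ‖ξ‖ < R → (levySymbol ν ξ).re ≤ 1 / s) →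
    ∫⁻ ξ, ENNReal.ofReal (Real.exp (-(s * (levySymbol ν ξ).re)) * ‖ξ‖ ^ (d + 2))
      ≤ ENNReal.ofReal (C₁ * R ^ (2 * d + 2)) →
    ∀ h : EuclideanSpace ℝ (Fin d) → ℂ,
    (∀ ξ, h ξ = Complex.exp (-(s * compensatedSymbol (ν.restrict {z | ‖z‖ ≤ 4 * d / R}) ξ))) →
    Integrable h ∧ Integrable (fun v => ‖v‖ * ‖h v‖) ∧
    ∫⁻ x, ‖𝓕 h x‖ₑ < ∞ ∧ ∫⁻ x, ‖fderiv ℝ (𝓕 h) x‖ₑ ≤ ENNReal.ofReal (c * R) := by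
  have hd' : (0 : ℝ) < d := by exact_mod_cast hd
  set vol : ℝ := volume.real (Metric.closedBall (0 : EuclideanSpace ℝ (Fin d)) 1) with hvol
  obtain ⟨c, hc⟩ := exists_lintegral_fourier_exp_compensatedSymbol_le
    (EuclideanSpace ℝ (Fin d)) (4 * d) (80 * d ^ 3)
    (Real.exp (4 * d) * (2 ^ (d + 2) * (vol + |C₁|)))
  refine ⟨|c|, fun ν hν s R hs hR hΨ hint h hh => ?_⟩
  -- The symbol is controlled on the open ball of radius `R` only, so the large jumps are estimated
  -- with `R / 2`; this gives the truncation level `2 d / (R / 2)`.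
  set r : ℝ := 4 * d / R with hr
  have hr0 : 0 < r := by positivity
  set σ := ν.restrict {z | ‖z‖ ≤ r} with hσ
  set ρ := rescaledJumps σ s R with hρ
  have hm : AEMeasurable (fun z : EuclideanSpace ℝ (Fin d) => R • z) σ :=
    (measurable_const_smul R).aemeasurable
  have hlarge : ν.real {z | r < ‖z‖} ≤ 2 * d / s := by
    have h1 := hν.measure_norm_gt_le hd (R := R / 2) (b := 1 / s) (by positivity)
      fun ξ hξ => hΨ ξ (by linarith)
    have h2 : 2 * d / (R / 2) = r := by rw [hr]; field_simp; norm_num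
    rw [h2] at h1
    exact h1.trans (le_of_eq (by ring))
  have hsmall : ∫ z, ‖z‖ ^ 2 ∂σ ≤ 80 * d ^ 3 / (s * R ^ 2) := by
    have hd1 : (1 : ℝ) ≤ d := by exact_mod_cast hd
    have h1 := hν.integral_sq_le (R := R / (4 * d)) (b := 1 / s) (r := r) (by positivity)
      (fun ξ hξ => hΨ ξ (hξ.trans_lt ((div_lt_iff₀ (by positivity)).2 (by nlinarith))))
      (le_of_eq (by rw [hr]; field_simp))
    refine h1.trans (le_of_eq ?_)
    field_simp
    norm_num
  have hK : ∀ᵐ z ∂ρ, ‖z‖ ≤ 4 * d := by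
    refine Measure.ae_smul_measure ?_ _
    rw [ae_map_iff hm (measurableSet_norm_le _)]
    refine (ae_restrict_iff' (measurableSet_norm_le r)).2 (Eventually.of_forall fun z hz => ?_)
    rw [norm_smul, Real.norm_of_nonneg hR.le]
    calc R * ‖z‖ ≤ R * r := by gcongr; exact hz
      _ = 4 * d := by rw [hr]; field_simp
  have hσi : Integrable (fun z => ‖z‖ ^ 2) σ := hν.integrable_sq_restrict r
  have hρi : Integrable (fun z => ‖z‖ ^ 2) ρ := by
    refine Integrable.smul_measure ?_ ENNReal.ofReal_ne_top
    rw [integrable_map_measure (by fun_prop : Continuous _).aestronglyMeasurable hm]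
    refine (hσi.const_mul (R ^ 2)).congr (Eventually.of_forall fun z => ?_)
    simp [norm_smul, mul_pow]
  have hρM : ∫ z, ‖z‖ ^ 2 ∂ρ ≤ 80 * d ^ 3 := by
    rw [hρ, rescaledJumps, integral_smul_measure,
      integral_map hm (by fun_prop : Continuous _).aestronglyMeasurable,
      ENNReal.toReal_ofReal hs.le, smul_eq_mul]
    have h1 : ∫ z, ‖R • z‖ ^ 2 ∂σ = R ^ 2 * ∫ z, ‖z‖ ^ 2 ∂σ := by
      rw [← integral_const_mul]
      congr 1 with z
      simp [norm_smul, mul_pow]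
    rw [h1]
    rw [le_div_iff₀ (by positivity)] at hsmall
    linarith
  set f : EuclideanSpace ℝ (Fin d) → ℂ := fun v => Complex.exp (-compensatedSymbol ρ v) with hf
  have hfc : Continuous f := by
    have := continuous_compensatedSymbol hK hρi
    fun_prop
  have hhf : h = fun ξ => f (R⁻¹ • ξ) := by
    funext ξ
    rw [hh, hf]
    dsimp only
    rw [hρ, compensatedSymbol_rescaledJumps σ hs.le, smul_smul, mul_inv_cancel₀ hR.ne', one_smul]
  set a : ℝ := R * (2 * Real.pi) with ha
  have ha0 : 0 < a := by positivity
  set u : EuclideanSpace ℝ (Fin d) → ℝ :=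
    fun ξ => Real.exp (-(s * (levySymbol ν ξ).re)) with hu
  have hu1 : ∀ ξ, u ξ ≤ 1 := fun ξ => by
    rw [hu, Real.exp_le_one_iff, neg_nonpos, hν.re_levySymbol]
    exact mul_nonneg hs.le (integral_nonneg fun z => one_sub_cos_nonneg _)
  have hfu : ∀ v, ‖f v‖ ≤ Real.exp (4 * d) * u (a • v) := by
    intro v
    rw [hf, hu]
    dsimp only
    rw [Complex.norm_exp, ← Real.exp_add, hρ, compensatedSymbol_rescaledJumps σ hs.le,
      Complex.neg_re, Complex.re_ofReal_mul]
    refine Real.exp_le_exp.2 ?_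
    have h1 := hν.re_levySymbol_le hr0 (R • v)
    have h2 : a • v = (2 * Real.pi) • R • v := by rw [smul_smul, ha, mul_comm]
    rw [h2]
    have h3 := mul_le_mul_of_nonneg_left h1 hs.le
    have h4 := mul_le_mul_of_nonneg_left hlarge hs.le
    rw [mul_div_cancel₀ _ hs.ne'] at h4
    linarith
  -- The substitution `ξ = a v` produces `R ^ (-(2 d + 2))`, which cancels the power of `R = Ξ(s)`
  -- in the integral condition.
  have hscale : ∫⁻ v, ENNReal.ofReal (u (a • v) * ‖v‖ ^ (d + 2)) ≤ ENNReal.ofReal |C₁| := by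
    have h1 : ∀ v : EuclideanSpace ℝ (Fin d), ENNReal.ofReal (u (a • v) * ‖v‖ ^ (d + 2))
        = ENNReal.ofReal (a ^ (d + 2))⁻¹ * ENNReal.ofReal (u (a • v) * ‖a • v‖ ^ (d + 2)) := by
      intro v
      rw [← ENNReal.ofReal_mul (by positivity), norm_smul, Real.norm_of_nonneg ha0.le, mul_pow]
      congr 1
      have h2 : (a ^ (d + 2))⁻¹ * a ^ (d + 2) = 1 := inv_mul_cancel₀ (by positivity)
      linear_combination -(u (a • v) * ‖v‖ ^ (d + 2)) * h2
    simp only [h1]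
    rw [lintegral_const_mul' _ _ ENNReal.ofReal_ne_top,
      lintegral_comp_smul_of_pos (fun ξ => ENNReal.ofReal (u ξ * ‖ξ‖ ^ (d + 2))) ha0,
      finrank_euclideanSpace_fin]
    calc _ ≤ ENNReal.ofReal (a ^ (d + 2))⁻¹ * (ENNReal.ofReal (a ^ d)⁻¹
          * ENNReal.ofReal (|C₁| * R ^ (2 * d + 2))) := by
          gcongr
          refine hint.trans (ENNReal.ofReal_le_ofReal ?_)
          gcongr
          exact le_abs_self C₁
      _ = ENNReal.ofReal (|C₁| * ((2 * Real.pi) ^ (2 * d + 2))⁻¹) := by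
          rw [← ENNReal.ofReal_mul (by positivity), ← ENNReal.ofReal_mul (by positivity)]
          congr 1
          have h2 : a ^ (d + 2) * a ^ d = R ^ (2 * d + 2) * (2 * Real.pi) ^ (2 * d + 2) := by
            rw [ha]; ring
          have h3 : (R ^ (2 * d + 2))⁻¹ * R ^ (2 * d + 2) = 1 := inv_mul_cancel₀ (by positivity)
          rw [← mul_assoc, ← mul_inv, h2, mul_inv]
          linear_combination |C₁| * ((2 * Real.pi) ^ (2 * d + 2))⁻¹ * h3
      _ ≤ _ := by
          refine ENNReal.ofReal_le_ofReal (mul_le_of_le_one_right (abs_nonneg _) ?_)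
          refine inv_le_one_of_one_le₀ (one_le_pow₀ ?_)
          linarith [Real.pi_gt_three]
  have hW : ∫⁻ v, ENNReal.ofReal ((1 + ‖v‖) ^ (d + 2) * ‖f v‖)
      ≤ ENNReal.ofReal (Real.exp (4 * d) * (2 ^ (d + 2) * (vol + |C₁|))) := by
    calc _ ≤ ∫⁻ v, ENNReal.ofReal (Real.exp (4 * d))
          * ENNReal.ofReal ((1 + ‖v‖) ^ (d + 2) * u (a • v)) := by
          refine lintegral_mono fun v => ?_
          rw [← ENNReal.ofReal_mul (by positivity)]
          refine ENNReal.ofReal_le_ofReal ?_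
          calc _ ≤ (1 + ‖v‖) ^ (d + 2) * (Real.exp (4 * d) * u (a • v)) := by
                gcongr; exact hfu v
            _ = _ := by ring
      _ ≤ ENNReal.ofReal (Real.exp (4 * d)) * (ENNReal.ofReal (2 ^ (d + 2)) *
          (volume (Metric.closedBall (0 : EuclideanSpace ℝ (Fin d)) 1) + ENNReal.ofReal |C₁|)) := by
          rw [lintegral_const_mul' _ _ ENNReal.ofReal_ne_top]
          gcongr
          refine (lintegral_one_add_norm_pow_mul_le (d + 2) (fun v => u (a • v))
            (fun v => (Real.exp_pos _).le) fun v => hu1 _).trans ?_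
          gcongr
      _ = _ := by
          have h1 : volume (Metric.closedBall (0 : EuclideanSpace ℝ (Fin d)) 1)
              = ENNReal.ofReal vol := by
            rw [hvol, measureReal_def, ENNReal.ofReal_toReal measure_closedBall_lt_top.ne]
          rw [h1, ← ENNReal.ofReal_add measureReal_nonneg (abs_nonneg _),
            ← ENNReal.ofReal_mul (by positivity), ← ENNReal.ofReal_mul (by positivity)]
  have hWi : Integrable (fun v => (1 + ‖v‖) ^ (d + 2) * ‖f v‖) := by
    refine ⟨(by fun_prop : Continuous _).aestronglyMeasurable, ?_⟩
    rw [hasFiniteIntegral_iff_ofReal (Eventually.of_forall fun v => by positivity)]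
    exact hW.trans_lt ENNReal.ofReal_lt_top
  have hone : ∀ v : EuclideanSpace ℝ (Fin d), 1 + ‖v‖ ≤ (1 + ‖v‖) ^ (d + 2) := fun v =>
    le_self_pow₀ (by linarith [norm_nonneg v]) (by omega)
  have hfi : Integrable f := by
    refine hWi.mono' hfc.aestronglyMeasurable (Eventually.of_forall fun v => ?_)
    refine le_mul_of_one_le_left (norm_nonneg _) ?_
    linarith [hone v, norm_nonneg v]
  have hfi' : Integrable (fun v => ‖v‖ * ‖f v‖) := by
    refine hWi.mono' (by fun_prop : Continuous _).aestronglyMeasurable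
      (Eventually.of_forall fun v => ?_)
    rw [Real.norm_of_nonneg (by positivity)]
    gcongr
    linarith [hone v, norm_nonneg v]
  have hbd := hc ρ hK hρi hρM (by rw [finrank_euclideanSpace_fin]; exact hW)
  have h0 := hbd 0 (by norm_num)
  have h1 := hbd 1 le_rfl
  have hnorm : ∀ x, ‖iteratedFDeriv ℝ 1 (𝓕 f) x‖ₑ = ‖fderiv ℝ (𝓕 f) x‖ₑ := fun x => by
    have h2 := norm_iteratedFDeriv_fderiv (𝕜 := ℝ) (f := 𝓕 f) (x := x) (n := 0)
    rw [norm_iteratedFDeriv_zero, zero_add] at h2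
    rw [← ofReal_norm, ← ofReal_norm, h2]
  have hnorm0 : ∀ x, ‖iteratedFDeriv ℝ 0 (𝓕 f) x‖ₑ = ‖𝓕 f x‖ₑ := fun x => by
    rw [← ofReal_norm, ← ofReal_norm, norm_iteratedFDeriv_zero]
  simp only [← hf, hnorm] at h1
  simp only [← hf, hnorm0] at h0
  refine ⟨?_, ?_, ?_, ?_⟩
  · rw [hhf]
    exact hfi.comp_smul (inv_ne_zero hR.ne')
  · have h2 := (hfi'.comp_smul (inv_ne_zero hR.ne')).const_mul R
    refine h2.congr (Eventually.of_forall fun v => ?_)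
    simp only [hhf, norm_smul, norm_inv, Real.norm_of_nonneg hR.le]
    field_simp
  · rw [hhf, lintegral_fourier_comp_inv_smul f hR]
    exact h0.trans_lt ENNReal.ofReal_lt_top
  · rw [hhf, lintegral_fderiv_fourier_comp_inv_smul f hR (Real.differentiable_fourier hfi hfi'),
      mul_comm |c|, ENNReal.ofReal_mul hR.le]
    gcongr
    exact h1.trans (ENNReal.ofReal_le_ofReal (le_abs_self c))

end SmallJumps

/-! ### The density of the Lévy process -/

/-- The integral bound forces `Ξ(s)` to be positive, since its left-hand side is. -/
theorem levyXi_pos {d : ℕ} (hd : 1 ≤ d) {ν : Measure (EuclideanSpace ℝ (Fin d))} {s C₁ : ℝ}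
    (μ : Measure (EuclideanSpace ℝ (Fin d))) [IsProbabilityMeasure μ]
    (hμ : ∀ ξ, charFun μ ξ = Complex.exp (-((s : ℂ) * levySymbol ν ξ)))
    (hint : ∫⁻ ξ : EuclideanSpace ℝ (Fin d),
          ENNReal.ofReal (Real.exp (-(s * (levySymbol ν ξ).re)) * ‖ξ‖ ^ (d + 2))
        ≤ ENNReal.ofReal (C₁ * levyXi ν s ^ (2 * d + 2))) :
    0 < levyXi ν s := by
  have h0 : 0 ≤ levyXi ν s := Real.sInf_nonneg fun η hη => hη.1
  refine lt_of_le_of_ne h0 fun hXi => ?_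
  rw [← hXi, zero_pow (by omega), mul_zero, ENNReal.ofReal_zero, nonpos_iff_eq_zero] at hint
  have h1 : ∀ ξ, Real.exp (-(s * (levySymbol ν ξ).re)) = ‖charFun μ ξ‖ := fun ξ => by
    rw [hμ, Complex.norm_exp, Complex.neg_re, Complex.re_ofReal_mul]
  have h2 : Continuous fun ξ : EuclideanSpace ℝ (Fin d) =>
      ENNReal.ofReal (Real.exp (-(s * (levySymbol ν ξ).re)) * ‖ξ‖ ^ (d + 2)) := by
    simp only [h1]
    exact ENNReal.continuous_ofReal.comp (by fun_prop)
  rw [lintegral_eq_zero_iff h2.measurable] at hint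
  have h3 : ENNReal.ofReal (_ * _) = 0 := congrFun
    ((h2.ae_eq_iff_eq volume continuous_const).1 hint) (EuclideanSpace.single ⟨0, hd⟩ 1)
  rw [PiLp.norm_single, norm_one, one_pow, mul_one, ENNReal.ofReal_eq_zero] at h3
  exact absurd h3 (not_le.2 (Real.exp_pos _))

theorem mainTheorem8 {d : ℕ} (hd : 1 ≤ d) {Ω : Type*} [MeasurableSpace Ω]
    (P : Measure Ω) [IsProbabilityMeasure P]
    (Z : ℝ≥0 → Ω → EuclideanSpace ℝ (Fin d)) (hZ : IsLevyProcess Z P)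
    (ν : Measure (EuclideanSpace ℝ (Fin d))) (hν : IsLevyMeasure ν)
    (hsymbol : ∀ (t : ℝ≥0) (ξ : EuclideanSpace ℝ (Fin d)),
      charFun (P.map (Z t)) ξ = Complex.exp (-(((t : ℝ) : ℂ) * levySymbol ν ξ)))
    (hlog : Tendsto (fun ξ : EuclideanSpace ℝ (Fin d) =>
      (levySymbol ν ξ).re / Real.log (1 + ‖ξ‖)) (Bornology.cobounded _) atTop)
    (hint : ∃ t₀ : ℝ, 0 < t₀ ∧ ∃ C₁ : ℝ, 0 < C₁ ∧ ∀ t : ℝ, 0 < t → t < t₀ →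
      ∫⁻ ξ : EuclideanSpace ℝ (Fin d),
          ENNReal.ofReal (Real.exp (-(t * (levySymbol ν ξ).re)) * ‖ξ‖ ^ (d + 2))
        ≤ ENNReal.ofReal (C₁ * levyXi ν t ^ (2 * d + 2))) :
    ∃ g : ℝ≥0 → EuclideanSpace ℝ (Fin d) → ℝ,
      (∀ t : ℝ≥0, 0 < t →
        (∀ z, 0 ≤ g t z) ∧
        P.map (Z t) = volume.withDensity (fun z => ENNReal.ofReal (g t z)) ∧
        ContDiff ℝ 1 (g t) ∧
        Integrable (∇ (g t)) volume) ∧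
      ∃ C₂ : ℝ, 0 < C₂ ∧ ∃ t₁ : ℝ, 0 < t₁ ∧ ∀ t : ℝ≥0, 0 < t →
        ∫ z, ‖∇ (g t) z‖ ≤ C₂ * levyXi ν (min (t : ℝ) t₁) := by
  obtain ⟨t₀, ht₀, C₁, -, hint⟩ := hint
  obtain ⟨c, hc⟩ := exists_smallJumps_bound hd C₁
  have hprob : ∀ t, IsProbabilityMeasure (P.map (Z t)) := fun t =>
    Measure.isProbabilityMeasure_map (hZ.measurable t).aemeasurable
  have hXi : ∀ s, 0 < s → s < t₀ → 0 < levyXi ν s := fun s hs hst => by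
    lift s to ℝ≥0 using hs.le
    exact levyXi_pos hd (P.map (Z s)) (hsymbol s) (hint s hs hst)
  set φ : ℝ≥0 → EuclideanSpace ℝ (Fin d) → ℂ :=
    fun t ξ => charFun (P.map (Z t)) ((2 * Real.pi) • ξ) with hφ
  have key : ∀ t : ℝ≥0, 0 < t →
      (∀ x, 0 ≤ (𝓕 (φ t) x).re) ∧
      P.map (Z t) = volume.withDensity (fun x => ENNReal.ofReal (𝓕 (φ t) x).re) ∧
      ContDiff ℝ 1 (fun x => (𝓕 (φ t) x).re) ∧
      ∫⁻ x, ‖∇ (fun x => (𝓕 (φ t) x).re) x‖ₑ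
        ≤ ENNReal.ofReal (c * levyXi ν (min (t : ℝ) (t₀ / 2))) := by
    intro t ht
    -- Only the time `s = min t (t₀ / 2)` is used for smoothing; the remaining increment is absorbed
    -- in the probability factor.
    set s : ℝ≥0 := min t (Real.toNNReal (t₀ / 2)) with hs
    have hsR : (s : ℝ) = min (t : ℝ) (t₀ / 2) := by
      rw [hs, NNReal.coe_min, Real.coe_toNNReal _ (by positivity)]
    have hs0 : (0 : ℝ) < s := by
      rw [hsR]; exact lt_min (by exact_mod_cast ht) (by positivity)
    have hst₀ : (s : ℝ) < t₀ := by rw [hsR]; exact (min_le_right _ _).trans_lt (by linarith)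
    have hst : s ≤ t := min_le_left _ _
    rw [← hsR]
    set R := levyXi ν s with hR
    have hR0 : 0 < R := hXi s hs0 hst₀
    set h : EuclideanSpace ℝ (Fin d) → ℂ := fun ξ =>
      Complex.exp (-(((s : ℝ) : ℂ) * compensatedSymbol (ν.restrict {z | ‖z‖ ≤ 4 * d / R}) ξ))
      with hh
    obtain ⟨hi, hi', hF, hF'⟩ := hc ν hν s R hs0 hR0
      (fun ξ hξ => hν.re_levySymbol_le_of_norm_lt_levyXi hξ) (hint s hs0 hst₀) h fun ξ => rfl
    obtain ⟨m, hm, hmul⟩ := hν.exists_charFun_mul (r := 4 * d / R)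
      (div_pos (by have : (0 : ℝ) < d := by exact_mod_cast hd
                   positivity) hR0) hs0.le
    obtain ⟨h1, h2, h3, h4⟩ := density_of_charFun_eq_mul (P.map (Z t)) (m ∗ P.map (Z (t - s)))
      (φ := φ t) hi hi' (fun ξ => rfl) (fun ξ => by
        have hts : (t : ℝ) = s + (t - s : ℝ≥0) := by
          rw [NNReal.coe_sub hst]; ring
        rw [hφ, hh]
        dsimp only
        rw [charFun_conv, hsymbol, hsymbol, mul_right_comm, ← hmul, ← Complex.exp_add, hts]
        congr 1
        push_cast
        ring) hF
    exact ⟨h1, h2, h3, h4.trans hF'⟩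
  have hgi : ∀ t : ℝ≥0, 0 < t → Integrable (∇ (fun x => (𝓕 (φ t) x).re)) := by
    intro t ht
    obtain ⟨-, -, h3, h4⟩ := key t ht
    refine ⟨Continuous.aestronglyMeasurable ?_, ?_⟩
    · exact (InnerProductSpace.toDual ℝ _).symm.continuous.comp
        (h3.continuous_fderiv (by simp))
    · rw [hasFiniteIntegral_iff_enorm]
      exact h4.trans_lt ENNReal.ofReal_lt_top
  refine ⟨fun t x => (𝓕 (φ t) x).re, fun t ht => ?_, |c| + 1, by positivity, t₀ / 2,
    by positivity, fun t ht => ?_⟩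
  · obtain ⟨h1, h2, h3, -⟩ := key t ht
    exact ⟨h1, h2, h3, hgi t ht⟩
  · obtain ⟨-, -, -, h4⟩ := key t ht
    have hX : 0 < levyXi ν (min (t : ℝ) (t₀ / 2)) :=
      hXi _ (lt_min (by exact_mod_cast ht) (by positivity))
        ((min_le_right _ _).trans_lt (by linarith))
    rw [integral_norm_eq_lintegral_enorm (hgi t ht).1]
    refine ENNReal.toReal_le_of_le_ofReal (by positivity) (h4.trans ?_)
    refine ENNReal.ofReal_le_ofReal ?_
    gcongr
    linarith [le_abs_self c]
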